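/- For a finite simple graph $G$ and an integer $k\ge 2$, let $R(G,\mathbb{Z}_k)$ be the least $N$ (if it exists) such that for every coloring $f:E(K_N)\to\mathbb{Z}_k$ of the edges of the complete graph $K_N$ there is a copy $G'$ of $G$ in $K_N$ with $\sum_{e\in E(G')}f(e)=0$. A \emph{2-packing} of $G$ is a set $S\subseteq V(G)$ such that $N[u]\cap N[v]=\emptyset$ for all distinct $u,v\in S$, where $N[u]=N(u)\cup\{u\}$ is the closed neighborhood. Theorem. Let $p$ be prime. Suppose $G$ is an $n$-vertex graph such that $p$ divides the number of edges $e(G)$, the minimum degree of $G$ is at least $1$, and there exists a 2-packing $S$ of $G$ with $|S|=p-1$. Let $s_0=|\{v\in S:\deg(v)\equiv 0 \pmod p\}|$, and let $c=0$ if $V(G)\neq\bigcup_{v\in S}N[v]$ or $\deg(v)=1$ for all $v\in S$, and $c=1$ otherwise. Then $R(G,\mathbb{Z}_p)$ exists, and $$R(G,\mathbb{Z}_p)\le\begin{cases} n+p-1+c & \text{if } s_0=0,\\ n+5p-9+s_0+c & \text{if } s_0\neq 0.\end{cases}$$ In particular, $R(G,\mathbb{Z}_p)\le n+6p-9$ in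 every case. Moreover, if $s_0=c=0$ and there exists an integer $d\not\equiv 0\pmod p$ such that $\deg(v)\equiv d\pmod p$ for all $v\in V(G)$, then $R(G,\mathbb{Z}_p)=n+p-1$. -/

import Mathlib

namespace ZeroSumRamsey

variable {V : Type*}

/-- The closed neighborhood `N[v] = N(v) ∪ {v}`. -/
def closedNeighborSet (G : SimpleGraph V) (v : V) : Set V :=
  G.neighborSet v ∪ {v}

/-- `S` is a 2-packing of `G`: the closed neighborhoods of distinct vertices of `S` are disjoint. -/
def IsTwoPacking (G : SimpleGraph V) (S : Finset V) : Prop :=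
  ∀ u ∈ S, ∀ v ∈ S, u ≠ v → closedNeighborSet G u ∩ closedNeighborSet G v = ∅

/-- The sum of the colors of the edges of a copy of `G` in the complete graph on `W`. A copy is given
by an injective homomorphism `φ`; its edges are the images under `φ` of the edges of `G`, each
exactly once. -/
def copySum {W Γ : Type*} [AddCommGroup Γ] (G : SimpleGraph V) [Fintype G.edgeSet]
    (f : (⊤ : SimpleGraph W).edgeSet → Γ) (φ : G.Copy (⊤ : SimpleGraph W)) : Γ :=
  ∑ e : G.edgeSet, f (φ.toHom.mapEdgeSet e)

/-- Every coloring of the edges of `K_N` by elements of `Γ` contains a zero-sum copy of `G`. -/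
def ForcesZeroSumCopy (G : SimpleGraph V) [Fintype G.edgeSet] (Γ : Type*) [AddCommGroup Γ]
    (N : ℕ) : Prop :=
  ∀ f : (⊤ : SimpleGraph (Fin N)).edgeSet → Γ,
    ∃ φ : G.Copy (⊤ : SimpleGraph (Fin N)), copySum G f φ = 0

/-- The zero-sum Ramsey number `R(G, Γ)` exists. -/
def RamseyExists (G : SimpleGraph V) [Fintype G.edgeSet] (Γ : Type*) [AddCommGroup Γ] : Prop :=
  ∃ N : ℕ, ForcesZeroSumCopy G Γ N

/-- The zero-sum Ramsey number `R(G, Γ)`: the least `N` such that every coloring of the edges of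
`K_N` by elements of `Γ` contains a zero-sum copy of `G`. It is meaningful only together with
`RamseyExists G Γ` (otherwise the infimum is over the empty set). -/
noncomputable def ramseyNumber (G : SimpleGraph V) [Fintype G.edgeSet] (Γ : Type*)
    [AddCommGroup Γ] : ℕ :=
  sInf {N : ℕ | ForcesZeroSumCopy G Γ N}

/-- `s₀`: the number of vertices in `S` whose degree is congruent to `0` modulo `p`. -/
def sZero [Fintype V] (G : SimpleGraph V) [DecidableRel G.Adj] (p : ℕ) (S : Finset V) : ℕ :=
  (S.filter fun v => G.degree v ≡ 0 [MOD p]).card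

open Classical in
/-- `c`: it is `0` if the closed neighborhoods of the vertices in `S` do not cover all vertices, or
if all vertices in `S` have degree one; it is `1` otherwise. -/
noncomputable def cConst [Fintype V] (G : SimpleGraph V) [DecidableRel G.Adj] (S : Finset V) : ℕ :=
  if (Set.univ : Set V) ≠ ⋃ v ∈ S, closedNeighborSet G v ∨ ∀ v ∈ S, G.degree v = 1 then 0 else 1

end ZeroSumRamsey

/-!
The upper bounds come from *switches*. A switch of degree `d` consists of two vertices `a`, `b`
and `d` further vertices such that the stars from `a` and from `b` to these vertices have
different sums. Given disjoint switches of the degrees of the `p - 1` vertices of the 2-packing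
`S`, place the neighbors of each `v ∈ S` on the leaves of its switch; then `v` can go to either
center. The vertices of `S` are pairwise nonadjacent, so the `p - 1` choices change the sum
independently of each other, and by the Cauchy–Davenport theorem all residues occur
(`exists_zero_sum_of_switches`).

If no degree in `S` is divisible by `p`, a switch is obtained from any non-monochromatic triangle
by adding vertices (`exists_isSwitch_of_ne`), so `p - 1` disjoint non-monochromatic triangles
suffice. Otherwise take a maximum packing of such triangles. The vertices outside form a
monochromatic clique, of color `z` say, and exchange arguments in the style of augmenting paths
show that after the deletion of one vertex from each triangle there remain a clique `K` of color
`z` and fewer than `p - 1` vertices, each with at most one edge to `K` of another color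
(`exists_packing_or_clique`). Those vertices can be used for vertices of `S`, which yields a copy
all of whose edges have color `z` (`exists_mono_copy`); its sum is zero because `p` divides the
number of edges.

If some degree in `S` is divisible by `p`, switches are obtained from quadruples `a`, `b`, `w`,
`w'` with `F a w - F b w ≠ F a w' - F b w'` (`exists_isSwitch_of_sub_ne`). If there are no `p - 1`
disjoint ones, then on a set of at least `n + p - 1` vertices the coloring has the form
`g u + g v + C` (`exists_additive`). There the sum of a copy is the sum of the values of `g` weighted by the
degrees. The degrees sum to `0` modulo `p`, and the weighted Erdős–Ginzburg–Ziv theorem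
(`exists_weighted_sum_eq_zero`) gives a zero-sum copy.

For the lower bound, color each edge by the number of its endpoints in a fixed set of `p - 1`
vertices (`not_forcesZeroSumCopy`).
-/

namespace ZeroSumRamsey

open Finset

/-! ### Sums over the edges of a graph -/

section EdgeSums

variable {V W Γ : Type*} [Fintype V] [DecidableEq V] [AddCommGroup Γ]

/-- A sum over the edges incident to `v`, written as a sum over the neighbors of `v`. -/
lemma sum_incidenceFinset (G : SimpleGraph V) [DecidableRel G.Adj] (g : Sym2 V → Γ) (v : V) :
    ∑ e ∈ G.incidenceFinset v, g e = ∑ u ∈ G.neighborFinset v, g s(v, u) := by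
  symm
  refine Finset.sum_bij (fun u _ => s(v, u)) ?_ ?_ ?_ ?_
  · intro u hu
    rw [SimpleGraph.mem_neighborFinset] at hu
    rw [SimpleGraph.mem_incidenceFinset]
    exact ⟨hu, by simp⟩
  · intro a _ b _ hab
    exact Sym2.congr_right.1 hab
  · intro e he
    rw [SimpleGraph.mem_incidenceFinset] at he
    obtain ⟨he, hv⟩ := he
    obtain ⟨u, rfl⟩ := Sym2.mem_iff_exists.1 hv
    exact ⟨u, by simpa using he, rfl⟩
  · intro _ _
    rfl

/-- If `S` is independent, then every edge meets `S` in at most one vertex, so the sum over the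
edges splits into the edges that avoid `S` and the stars of the vertices of `S`. -/
lemma sum_edgeFinset_eq_add_sum_stars (G : SimpleGraph V) [DecidableRel G.Adj] (g : Sym2 V → Γ)
    (S : Finset V) (hS : ∀ u ∈ S, ∀ v ∈ S, ¬ G.Adj u v) :
    ∑ e ∈ G.edgeFinset, g e =
      ∑ e ∈ G.edgeFinset with ∀ v ∈ S, v ∉ e, g e +
        ∑ v ∈ S, ∑ u ∈ G.neighborFinset v, g s(v, u) := by
  rw [← Finset.sum_filter_add_sum_filter_not G.edgeFinset (fun e => ∀ v ∈ S, v ∉ e)]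
  congr 1
  have hbU : G.edgeFinset.filter (fun e => ¬ ∀ v ∈ S, v ∉ e) =
      S.biUnion (fun v => G.incidenceFinset v) := by
    ext e
    simp only [mem_filter, mem_biUnion, SimpleGraph.incidenceFinset_eq_filter]
    push Not
    tauto
  rw [hbU, Finset.sum_biUnion]
  · exact Finset.sum_congr rfl fun v _ => sum_incidenceFinset G g v
  · intro u hu v hv huv
    rw [Function.onFun, Finset.disjoint_left]
    intro e heu hev
    rw [SimpleGraph.mem_incidenceFinset] at heu hev
    have : e = s(u, v) := (Sym2.mem_and_mem_iff huv).1 ⟨heu.2, hev.2⟩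
    subst this
    exact hS u hu v hv heu.1

/-- For a coloring of the form `h x + h y + C`, the edge sum is the degree-weighted sum of `h` plus
the number of edges times `C`. -/
lemma sum_edgeFinset_additive {R : Type*} [CommRing R] (G : SimpleGraph V) [DecidableRel G.Adj]
    (g : Sym2 V → R) (h : V → R) (C : R) (hg : ∀ u v, G.Adj u v → g s(u, v) = h u + h v + C) :
    ∑ e ∈ G.edgeFinset, g e = ∑ v, (G.degree v : R) * h v + (#G.edgeFinset : R) * C := by
  have h1 : ∀ e ∈ G.edgeFinset, g e = (∑ v, if v ∈ e then h v else 0) + C := by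
    intro e he
    induction e using Sym2.ind with
    | _ u v =>
      rw [SimpleGraph.mem_edgeFinset, SimpleGraph.mem_edgeSet] at he
      rw [hg u v he]
      congr 1
      rw [← Finset.sum_filter]
      have : (univ.filter fun x => x ∈ s(u, v)) = {u, v} := by
        ext x
        simp
      rw [this, Finset.sum_pair he.ne]
  rw [Finset.sum_congr rfl h1, Finset.sum_add_distrib, Finset.sum_comm, Finset.sum_const,
    nsmul_eq_mul]
  congr 1
  refine Finset.sum_congr rfl fun v _ => ?_
  rw [← Finset.sum_filter, ← SimpleGraph.incidenceFinset_eq_filter, Finset.sum_const, nsmul_eq_mul,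
    SimpleGraph.card_incidenceFinset_eq_degree]

end EdgeSums

/-! ### The Cauchy–Davenport theorem for many summands -/

/-- If `A i` are nonempty sets in `ZMod p` with `∑ (#(A i) - 1) ≥ p - 1`, then every residue is a
sum of representatives of the sets `A i`. -/
lemma exists_choice_sum_eq {ι : Type*} [DecidableEq ι] {p : ℕ} (hp : p.Prime) (s : Finset ι)
    (A : ι → Finset (ZMod p)) (hA : ∀ i ∈ s, (A i).Nonempty) (hs : p ≤ ∑ i ∈ s, (#(A i) - 1) + 1)
    (z : ZMod p) : ∃ g : ι → ZMod p, (∀ i ∈ s, g i ∈ A i) ∧ ∑ i ∈ s, g i = z := by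
  have := Fact.mk hp
  have key : ∀ s : Finset ι, (∀ i ∈ s, (A i).Nonempty) → ∃ B : Finset (ZMod p), B.Nonempty ∧
      min p (∑ i ∈ s, (#(A i) - 1) + 1) ≤ #B ∧
      ∀ z ∈ B, ∃ g : ι → ZMod p, (∀ i ∈ s, g i ∈ A i) ∧ ∑ i ∈ s, g i = z := by
    intro s
    induction s using Finset.induction_on with
    | empty => exact fun _ => ⟨{0}, by simp, by simp, by simp⟩
    | insert a s ha ih =>
      intro hs
      obtain ⟨B, hB, hcard, hrep⟩ := ih fun i hi => hs i (mem_insert_of_mem hi)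
      have hAa := hs a (mem_insert_self a s)
      have hpos := hAa.card_pos
      open Pointwise in
      refine ⟨A a + B, hAa.add hB, ?_, ?_⟩
      · have := ZMod.cauchy_davenport hp hAa hB
        rw [Finset.sum_insert ha]
        omega
      · intro z hz
        obtain ⟨x, hx, y, hy, rfl⟩ := Finset.mem_add.1 hz
        obtain ⟨g, hg, rfl⟩ := hrep y hy
        refine ⟨Function.update g a x, ?_, ?_⟩
        · intro i hi
          by_cases hia : i = a
          · subst hia
            simpa using hx
          · simpa [hia] using hg i ((mem_insert.1 hi).resolve_left hia)
        · rw [Finset.sum_insert ha, Function.update_self]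
          congr 1
          refine Finset.sum_congr rfl fun i hi => ?_
          rw [Function.update_of_ne (ne_of_mem_of_not_mem hi ha)]
  obtain ⟨B, -, hcard, hrep⟩ := key s hA
  refine hrep z ?_
  rw [min_eq_left hs] at hcard
  have : B = univ := by
    rw [← Finset.card_eq_iff_eq_univ, ZMod.card]
    exact le_antisymm ((Finset.card_le_univ B).trans_eq (ZMod.card p)) hcard
  simp [this]

/-! ### Extending partial injections -/

/-- A map that is injective on `D` extends to an injective map into `T`, if `T` is large enough. -/
lemma exists_injective_extension {V W : Type*} [Fintype V] [DecidableEq V] [DecidableEq W]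
    (D : Finset V) (T : Finset W) (f : V → W) (hf : Set.InjOn f D) (hD : ∀ v ∈ D, f v ∈ T)
    (hT : Fintype.card V ≤ #T) :
    ∃ φ : V → W, Function.Injective φ ∧ (∀ v ∈ D, φ v = f v) ∧ ∀ v, φ v ∈ T := by
  have hsub : D.image f ⊆ T := by
    intro w hw
    obtain ⟨v, hv, rfl⟩ := mem_image.1 hw
    exact hD v hv
  have hcard : #Dᶜ ≤ #(T \ D.image f) := by
    rw [Finset.card_sdiff_of_subset hsub, Finset.card_image_of_injOn hf, Finset.card_compl]
    omega
  have hcard' : Fintype.card ↥(Dᶜ) ≤ Fintype.card ↥(T \ D.image f) := by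
    rwa [Fintype.card_coe, Fintype.card_coe]
  obtain ⟨e⟩ := Function.Embedding.nonempty_of_card_le hcard'
  refine ⟨fun v => if h : v ∈ D then f v else e ⟨v, by simpa using h⟩, ?_, ?_, ?_⟩
  · have hne : ∀ u ∈ D, ∀ x, f u ≠ e x := by
      intro u hu x hx
      have := (mem_sdiff.1 (e x).2).2
      exact this (hx ▸ mem_image_of_mem f hu)
    intro u v huv
    by_cases hu : u ∈ D <;> by_cases hv : v ∈ D <;> simp only [hu, hv, dite_true, dite_false] at huv
    · exact hf hu hv huv
    · exact absurd huv (hne u hu _)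
    · exact absurd huv.symm (hne v hv _)
    · simpa using e.injective (Subtype.ext huv)
  · intro v hv
    simp [hv]
  · intro v
    by_cases hv : v ∈ D
    · simpa [hv] using hD v hv
    · simp only [hv, dite_false]
      exact (mem_sdiff.1 (e _).2).1

/-! ### Maximum packings of non-monochromatic triangles -/

section Packing

variable {W Γ : Type*} {F : W → W → Γ}

/-- The triangle on the three vertices of `T` is not monochromatic. -/
def NonMono (F : W → W → Γ) (T : W × W × W) : Prop :=
  ¬ (F T.1 T.2.1 = F T.1 T.2.2 ∧ F T.1 T.2.1 = F T.2.1 T.2.2)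

/-- The list of the vertices of the triangles in `l`. -/
def verts (l : List (W × W × W)) : List W :=
  l.flatMap fun T => [T.1, T.2.1, T.2.2]

@[simp] lemma verts_nil : verts ([] : List (W × W × W)) = [] := rfl

@[simp] lemma verts_cons (T : W × W × W) (l : List (W × W × W)) :
    verts (T :: l) = T.1 :: T.2.1 :: T.2.2 :: verts l := rfl

@[simp] lemma verts_append (l l' : List (W × W × W)) : verts (l ++ l') = verts l ++ verts l' :=
  List.flatMap_append

lemma length_verts (l : List (W × W × W)) : (verts l).length = 3 * l.length := by
  induction l with
  | nil => rfl
  | cons T l ih =>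
    simp only [verts_cons, List.length_cons, ih]
    ring

lemma verts_perm {l l' : List (W × W × W)} (h : l.Perm l') : (verts l).Perm (verts l') :=
  h.flatMap_right _

/-- A packing: a list of vertex-disjoint non-monochromatic triangles. -/
def IsPacking (F : W → W → Γ) (l : List (W × W × W)) : Prop :=
  (∀ T ∈ l, NonMono F T) ∧ (verts l).Nodup

/-- A packing of maximum length. -/
def IsMaxPacking (F : W → W → Γ) (l : List (W × W × W)) : Prop :=
  IsPacking F l ∧ ∀ l', IsPacking F l' → l'.length ≤ l.length

lemma IsPacking.perm {l l' : List (W × W × W)} (hl : IsPacking F l) (h : l.Perm l') :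
    IsPacking F l' :=
  ⟨fun T hT => hl.1 T (h.mem_iff.2 hT), (verts_perm h).nodup_iff.1 hl.2⟩

lemma IsMaxPacking.perm {l l' : List (W × W × W)} (hl : IsMaxPacking F l) (h : l.Perm l') :
    IsMaxPacking F l' :=
  ⟨hl.1.perm h, fun m hm => h.length_eq ▸ hl.2 m hm⟩

lemma IsMaxPacking.swap_left (hF : ∀ u v, F u v = F v u) {x y w : W} {l : List (W × W × W)}
    (hl : IsMaxPacking F ((x, y, w) :: l)) : IsMaxPacking F ((y, x, w) :: l) := by
  refine ⟨⟨?_, ?_⟩, hl.2⟩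
  · have h1 := hl.1.1
    simp only [List.mem_cons, forall_eq_or_imp, NonMono] at h1 ⊢
    refine ⟨fun h => h1.1 ?_, h1.2⟩
    rw [hF x y]
    exact ⟨h.2, h.1⟩
  · exact (List.Perm.swap y x _).nodup_iff.1 hl.1.2

lemma IsMaxPacking.swap_right (hF : ∀ u v, F u v = F v u) {x y w : W} {l : List (W × W × W)}
    (hl : IsMaxPacking F ((x, y, w) :: l)) : IsMaxPacking F ((x, w, y) :: l) := by
  refine ⟨⟨?_, ?_⟩, hl.2⟩
  · have h1 := hl.1.1
    simp only [List.mem_cons, forall_eq_or_imp, NonMono] at h1 ⊢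
    refine ⟨fun h => h1.1 ?_, h1.2⟩
    rw [hF y w]
    exact ⟨h.1.symm, h.1.symm.trans h.2⟩
  · exact ((List.Perm.swap w y _).cons x).nodup_iff.1 hl.1.2

/-- Replacing some triangles of a maximum packing by triangles on the same vertices and on
uncovered vertices cannot increase the number of triangles. -/
lemma IsMaxPacking.exchange {old rest new : List (W × W × W)} (hl : IsMaxPacking F (old ++ rest))
    (hnew : IsPacking F new)
    (hsub : ∀ v ∈ verts new, v ∈ verts old ∨ v ∉ verts (old ++ rest)) :
    new.length ≤ old.length := by
  have hnd := hl.1.2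
  rw [verts_append, List.nodup_append] at hnd
  have := hl.2 (new ++ rest) ⟨?_, ?_⟩
  · simpa using this
  · intro T hT
    rcases List.mem_append.1 hT with h | h
    · exact hnew.1 T h
    · exact hl.1.1 T (List.mem_append_right _ h)
  · rw [verts_append, List.nodup_append]
    refine ⟨hnew.2, hnd.2.1, ?_⟩
    rintro a ha _ hb rfl
    rcases hsub a ha with h | h
    · exact hnd.2.2 a h a hb rfl
    · rw [verts_append] at h
      exact h (List.mem_append_right _ hb)

lemma NonMono.of_ne {a b c : W} {z : Γ} (h : F a b ≠ z) (h' : F b c = z) : NonMono F (a, b, c) :=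
  fun hh => h (hh.2.trans h')

/-- Three distinct vertices outside the packing `l` that span a triangle of color `z`. -/
structure FreeTriangle (F : W → W → Γ) (l : List (W × W × W)) (z : Γ) (r s t : W) : Prop where
  nodup : [r, s, t].Nodup
  notMem : ∀ v ∈ [r, s, t], v ∉ verts l
  rs : F r s = z
  rt : F r t = z
  st : F s t = z

lemma FreeTriangle.rotate (hF : ∀ u v, F u v = F v u) {l : List (W × W × W)} {z : Γ} {r s t : W}
    (h : FreeTriangle F l z r s t) : FreeTriangle F l z s t r := by
  obtain ⟨h1, h2, h3, h4, h5⟩ := h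
  refine ⟨?_, ?_, h5, by rw [hF, h3], by rw [hF, h4]⟩
  · simp at h1 ⊢
    grind
  · simp at h2 ⊢
    grind

lemma FreeTriangle.swap (hF : ∀ u v, F u v = F v u) {l : List (W × W × W)} {z : Γ} {r s t : W}
    (h : FreeTriangle F l z r s t) : FreeTriangle F l z s r t := by
  obtain ⟨h1, h2, h3, h4, h5⟩ := h
  refine ⟨?_, ?_, by rw [hF, h3], h5, h4⟩
  · simp at h1 ⊢
    grind
  · simp at h2 ⊢
    grind

lemma FreeTriangle.perm {l l' : List (W × W × W)} {z : Γ} {r s t : W}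
    (h : FreeTriangle F l z r s t) (hl : l.Perm l') : FreeTriangle F l' z r s t :=
  ⟨h.nodup, fun v hv hv' => h.notMem v hv ((verts_perm hl).mem_iff.2 hv'), h.rs, h.rt, h.st⟩

lemma IsMaxPacking.nodup_append_free {old rest : List (W × W × W)}
    (hl : IsMaxPacking F (old ++ rest)) {z : Γ} {r s t : W}
    (hfree : FreeTriangle F (old ++ rest) z r s t) : (verts old ++ [r, s, t]).Nodup := by
  have hnd := hl.1.2
  rw [verts_append, List.nodup_append] at hnd
  refine List.nodup_append.2 ⟨hnd.1, hfree.nodup, ?_⟩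
  rintro a ha _ hb rfl
  exact hfree.notMem a hb (by rw [verts_append]; exact List.mem_append_left _ ha)

lemma IsMaxPacking.exchange_free {old rest : List (W × W × W)}
    (hl : IsMaxPacking F (old ++ rest)) {z : Γ} {r s t : W}
    (hfree : FreeTriangle F (old ++ rest) z r s t) (new : List (W × W × W))
    (hnew : ∀ T ∈ new, NonMono F T) (hnd : (verts new).Nodup)
    (hsub : verts new ⊆ verts old ++ [r, s, t]) : new.length ≤ old.length :=
  hl.exchange ⟨hnew, hnd⟩ fun v hv =>
    (List.mem_append.1 (hsub hv)).imp_right fun h => hfree.notMem v h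

/-- Two vertices of a triangle of a maximum packing cannot be joined in colors other than `z` to
two different vertices of a free triangle of color `z`. -/
lemma IsMaxPacking.not_ne_and_ne (hF : ∀ u v, F u v = F v u) {x y w : W} {l : List (W × W × W)}
    (hl : IsMaxPacking F ((x, y, w) :: l)) {z : Γ} {r s t : W}
    (hfree : FreeTriangle F ((x, y, w) :: l) z r s t) : ¬ (F x r ≠ z ∧ F y s ≠ z) := by
  rintro ⟨hx, hy⟩
  have hd := IsMaxPacking.nodup_append_free (old := [(x, y, w)]) (rest := l) hl hfree
  have key : ∀ a b c a' b' c' : W, [a, b, c, a', b', c'].Nodup →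
      [a, b, c, a', b', c'] ⊆ [x, y, w, r, s, t] →
      NonMono F (a, b, c) → ¬ NonMono F (a', b', c') := by
    intro a b c a' b' c' hp hsub hT hT'
    have := IsMaxPacking.exchange_free (old := [(x, y, w)]) (rest := l) hl hfree
      [(a, b, c), (a', b', c')] (by simp [hT, hT']) hp hsub
    simp at this
  obtain ⟨-, -, h3, h4, h5⟩ := hfree
  simp at hd
  -- each of four partitions into two triangles has a monochromatic part
  have k1 := key x r t y s w (by simp; grind) (by simp) (.of_ne hx h4)
  have k2 := key y s t x r w (by simp; grind) (by simp) (.of_ne hy h5)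
  have hxy : NonMono F (x, y, w) := hl.1.1 _ (by simp)
  simp only [NonMono, not_not] at k1 k2
  have k3 := key w s t x y r (by simp; grind) (by simp) (.of_ne (z := z) (by grind) h5)
  have k4 := key w r t x y s (by simp; grind) (by simp) (.of_ne (z := z) (by grind) h4)
  simp only [NonMono, not_not] at k3 k4 hxy
  exact hxy (by grind)

/-- If the edge `xy` of a triangle `xyw` of a maximum packing does not have color `z`, then `w` is
joined in color `z` to every free triangle of color `z`. -/
lemma IsMaxPacking.eq_of_ne (hF : ∀ u v, F u v = F v u) {x y w : W} {l : List (W × W × W)}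
    (hl : IsMaxPacking F ((x, y, w) :: l)) {z : Γ} (hxy : F x y ≠ z) {r s t : W}
    (hfree : FreeTriangle F ((x, y, w) :: l) z r s t) : F w r = z := by
  by_contra hw
  have hd := IsMaxPacking.nodup_append_free (old := [(x, y, w)]) (rest := l) hl hfree
  have key : ∀ a b c a' b' c' : W, [a, b, c, a', b', c'].Nodup →
      [a, b, c, a', b', c'] ⊆ [x, y, w, r, s, t] →
      NonMono F (a, b, c) → ¬ NonMono F (a', b', c') := by
    intro a b c a' b' c' hp hsub hT hT'
    have := IsMaxPacking.exchange_free (old := [(x, y, w)]) (rest := l) hl hfree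
      [(a, b, c), (a', b', c')] (by simp [hT, hT']) hp hsub
    simp at this
  simp at hd
  have k1 := key w r t x y s (by simp; grind) (by simp) (.of_ne hw hfree.rt)
  have k2 := key w r s x y t (by simp; grind) (by simp) (.of_ne hw hfree.rs)
  simp only [NonMono, not_not] at k1 k2
  exact hl.not_ne_and_ne hF (hfree.rotate hF) ⟨by grind, by grind⟩

/-- An edge of a packed triangle whose color is not `z` extends to a non-monochromatic triangle by
all vertices of a free triangle of color `z` but at most one. -/
lemma IsMaxPacking.nonMono_or (hF : ∀ u v, F u v = F v u) {x y w : W} {l : List (W × W × W)}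
    (hl : IsMaxPacking F ((x, y, w) :: l)) {z : Γ} (hxy : F x y ≠ z) {r s t : W}
    (hfree : FreeTriangle F ((x, y, w) :: l) z r s t) :
    NonMono F (x, y, r) ∨ NonMono F (x, y, s) := by
  have := hl.not_ne_and_ne hF hfree
  by_contra! h
  simp only [NonMono, not_not] at h
  exact this ⟨by grind, by grind⟩

section TwoTriangles

variable {x y w x' y' w' : W} {l : List (W × W × W)}

/-- The vertices opposite to edges not colored `z` in two triangles of a maximum packing are joined
in color `z`. -/
lemma IsMaxPacking.opposite_eq (hF : ∀ u v, F u v = F v u)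
    (hl : IsMaxPacking F ((x, y, w) :: (x', y', w') :: l)) {z : Γ} (hxy : F x y ≠ z)
    (hxy' : F x' y' ≠ z) {r s t : W}
    (hfree : FreeTriangle F ((x, y, w) :: (x', y', w') :: l) z r s t) : F w w' = z := by
  by_contra hw
  have hp := List.Perm.swap (x', y', w') (x, y, w) l
  have hl' := hl.perm hp
  have key : ∀ a b c : W, FreeTriangle F ((x, y, w) :: (x', y', w') :: l) z a b c →
      NonMono F (x, y, b) → ¬ NonMono F (x', y', c) := by
    intro a b c h hT hT'
    have hd := IsMaxPacking.nodup_append_free (old := [(x, y, w), (x', y', w')]) (rest := l) hl h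
    have ha := hl'.eq_of_ne hF hxy' (h.perm hp)
    have := IsMaxPacking.exchange_free (old := [(x, y, w), (x', y', w')]) (rest := l) hl h
      [(w, w', a), (x, y, b), (x', y', c)] (by simp [hT, hT', NonMono.of_ne hw ha])
      (by simp at hd ⊢; grind) (by simp)
    simp at this
  have h1 := hfree.rotate hF
  have h2 := h1.rotate hF
  rcases hl.nonMono_or hF hxy hfree with h | h
  · rcases hl'.nonMono_or hF hxy' (h1.perm hp) with h' | h'
    · exact key t r s h2 h h'
    · exact key s r t (hfree.swap hF) h h'
  · rcases hl'.nonMono_or hF hxy' (h2.perm hp) with h' | h'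
    · exact key r s t hfree h h'
    · exact key t s r (h1.swap hF) h h'

/-- In a maximum packing, the ends of an edge `xy` of color other than `z` cannot be joined in colors
other than `z` to the last vertex of another triangle and to a free vertex: the edges in question and
the free vertices would give three triangles in place of two. -/
lemma IsMaxPacking.not_opposite_ne_and_free_ne (hF : ∀ u v, F u v = F v u)
    (hl : IsMaxPacking F ((x, y, w) :: (x', y', w') :: l)) {z : Γ} (hxy : F x y ≠ z)
    (hxy' : F x' y' ≠ z) {r s t : W}
    (hfree : FreeTriangle F ((x, y, w) :: (x', y', w') :: l) z r s t) :
    ¬ (F x w' ≠ z ∧ F y r ≠ z) := by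
  rintro ⟨h1, h2⟩
  have hp := List.Perm.swap (x', y', w') (x, y, w) l
  have hw : F w' w = z := by
    rw [hF]
    exact hl.opposite_eq hF hxy hxy' hfree
  have key : ∀ b c : W, FreeTriangle F ((x, y, w) :: (x', y', w') :: l) z b r c →
      ¬ NonMono F (x', y', c) := by
    intro b c h hT
    have hd := IsMaxPacking.nodup_append_free (old := [(x, y, w), (x', y', w')]) (rest := l) hl h
    have hb : F r b = z := by rw [hF, h.rs]
    have := IsMaxPacking.exchange_free (old := [(x, y, w), (x', y', w')]) (rest := l) hl h
      [(x, w', w), (y, r, b), (x', y', c)] (by simp [hT, NonMono.of_ne h1 hw, NonMono.of_ne h2 hb])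
      (by simp at hd ⊢; grind) (by simp)
    simp at this
  rcases (hl.perm hp).nonMono_or hF hxy' ((hfree.perm hp).rotate hF) with h' | h'
  · exact key t s ((hfree.rotate hF).rotate hF) h'
  · exact key s t (hfree.swap hF) h'

/-- The analogous exchange for the last vertices of the same triangle and of another one. -/
lemma IsMaxPacking.not_own_ne_and_opposite_ne (hF : ∀ u v, F u v = F v u)
    (hl : IsMaxPacking F ((x, y, w) :: (x', y', w') :: l)) {z : Γ} (hxy : F x y ≠ z)
    (hxy' : F x' y' ≠ z) {r s t : W}
    (hfree : FreeTriangle F ((x, y, w) :: (x', y', w') :: l) z r s t) :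
    ¬ (F x w ≠ z ∧ F y w' ≠ z) := by
  rintro ⟨h1, h2⟩
  have hp := List.Perm.swap (x', y', w') (x, y, w) l
  have hl' := hl.perm hp
  have key : ∀ a b c : W, FreeTriangle F ((x, y, w) :: (x', y', w') :: l) z a b c →
      ¬ NonMono F (x', y', c) := by
    intro a b c h hT
    have hd := IsMaxPacking.nodup_append_free (old := [(x, y, w), (x', y', w')]) (rest := l) hl h
    have ha := hl.eq_of_ne hF hxy h
    have hb := hl'.eq_of_ne hF hxy' ((h.rotate hF).perm hp)
    have := IsMaxPacking.exchange_free (old := [(x, y, w), (x', y', w')]) (rest := l) hl h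
      [(x, w, a), (y, w', b), (x', y', c)] (by simp [hT, NonMono.of_ne h1 ha, NonMono.of_ne h2 hb])
      (by simp at hd ⊢; grind) (by simp)
    simp at this
  rcases hl'.nonMono_or hF hxy' (hfree.perm hp) with h' | h'
  · exact key s t r (hfree.rotate hF) h'
  · exact key t r s ((hfree.rotate hF).rotate hF) h'

/-- The analogous exchange for the last vertices of two other triangles, where four triangles would
replace three. -/
lemma IsMaxPacking.not_opposite_ne_and_opposite_ne (hF : ∀ u v, F u v = F v u) {x'' y'' w'' : W}
    (hl : IsMaxPacking F ((x, y, w) :: (x', y', w') :: (x'', y'', w'') :: l)) {z : Γ}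
    (hxy : F x y ≠ z) (hxy' : F x' y' ≠ z) (hxy'' : F x'' y'' ≠ z) {r s t : W}
    (hfree : FreeTriangle F ((x, y, w) :: (x', y', w') :: (x'', y'', w'') :: l) z r s t) :
    ¬ (F x w' ≠ z ∧ F y w'' ≠ z) := by
  rintro ⟨h1, h2⟩
  have hw : F w' w = z := by
    rw [hF]
    exact hl.opposite_eq hF hxy hxy' hfree
  have hp := List.Perm.swap (x', y', w') (x, y, w) ((x'', y'', w'') :: l)
  have hl' := hl.perm hp
  have hp' : ((x, y, w) :: (x', y', w') :: (x'', y'', w'') :: l).Perm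
      ((x'', y'', w'') :: (x, y, w) :: (x', y', w') :: l) :=
    ((List.Perm.swap _ _ _).cons _).trans (List.Perm.swap _ _ _)
  have hl'' := hl.perm hp'
  have key : ∀ a b c : W,
      FreeTriangle F ((x, y, w) :: (x', y', w') :: (x'', y'', w'') :: l) z a b c →
      NonMono F (x', y', b) → ¬ NonMono F (x'', y'', c) := by
    intro a b c h hT hT'
    have hd := IsMaxPacking.nodup_append_free (old := [(x, y, w), (x', y', w'), (x'', y'', w'')])
      (rest := l) hl h
    have ha := hl''.eq_of_ne hF hxy'' (h.perm hp')
    have := IsMaxPacking.exchange_free (old := [(x, y, w), (x', y', w'), (x'', y'', w'')])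
      (rest := l) hl h
      [(x, w', w), (y, w'', a), (x', y', b), (x'', y'', c)]
      (by simp [hT, hT', NonMono.of_ne h1 hw, NonMono.of_ne h2 ha])
      (by simp at hd ⊢; grind) (by simp)
    simp at this
  have k1 := hfree.rotate hF
  have k2 := k1.rotate hF
  rcases hl'.nonMono_or hF hxy' (hfree.perm hp) with h | h
  · rcases hl''.nonMono_or hF hxy'' (k1.perm hp') with h' | h'
    · exact key t r s k2 h h'
    · exact key s r t (hfree.swap hF) h h'
  · rcases hl''.nonMono_or hF hxy'' (k2.perm hp') with h' | h'
    · exact key r s t hfree h h'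
    · exact key t s r (k1.swap hF) h h'

end TwoTriangles

end Packing

/-! ### Colorings without many disjoint non-monochromatic triangles -/

section Structure

variable {W Γ : Type*} {F : W → W → Γ}

lemma FreeTriangle.congr {l l' : List (W × W × W)} {z : Γ} {r s t : W}
    (h : FreeTriangle F l z r s t) (hl : ∀ v, v ∈ verts l' → v ∈ verts l) :
    FreeTriangle F l' z r s t :=
  ⟨h.nodup, fun v hv hv' => h.notMem v hv (hl v hv'), h.rs, h.rt, h.st⟩

lemma mem_verts {l : List (W × W × W)} {v : W} :
    v ∈ verts l ↔ ∃ T ∈ l, v = T.1 ∨ v = T.2.1 ∨ v = T.2.2 := by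
  simp [verts, List.mem_flatMap]

lemma IsPacking.nodup {l : List (W × W × W)} (hl : IsPacking F l) : l.Nodup := by
  have h : ∀ l : List (W × W × W), (verts l).Nodup → l.Nodup := by
    intro l
    induction l with
    | nil => simp
    | cons T l ih =>
      intro h
      simp only [verts_cons, List.nodup_cons, List.mem_cons, not_or] at h
      refine List.nodup_cons.2 ⟨fun hT => h.1.2.2 ?_, ih h.2.2.2⟩
      exact mem_verts.2 ⟨T, hT, Or.inl rfl⟩
  exact h l hl.2

/-- Different triangles of a packing have no vertex in common. -/
lemma IsPacking.eq_of_mem {l : List (W × W × W)} (hl : IsPacking F l) {T T' : W × W × W}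
    (hT : T ∈ l) (hT' : T' ∈ l) {v : W} (hv : v ∈ verts [T]) (hv' : v ∈ verts [T']) : T = T' := by
  classical
  by_contra hne
  have hp := List.perm_cons_erase hT
  have hp' := List.perm_cons_erase ((List.mem_erase_of_ne (Ne.symm hne)).2 hT')
  have hnd := (hl.perm (hp.trans (hp'.cons T))).2
  simp at hv hv' hnd
  grind

/-- The triangles of a maximum packing can be ordered such that the first two vertices of each of
them span an edge whose color is not `z`. -/
lemma IsMaxPacking.exists_oriented (hF : ∀ u v, F u v = F v u) {l : List (W × W × W)}
    (hl : IsMaxPacking F l) (z : Γ) :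
    ∃ l', IsMaxPacking F l' ∧ l'.length = l.length ∧ (∀ v, v ∈ verts l' ↔ v ∈ verts l) ∧
      ∀ T ∈ l', F T.1 T.2.1 ≠ z := by
  have h1 : ∀ T : W × W × W, ∃ T' : W × W × W, (verts [T']).Perm (verts [T]) ∧
      (NonMono F T → NonMono F T' ∧ F T'.1 T'.2.1 ≠ z) := by
    rintro ⟨x, y, w⟩
    by_cases hxy : F x y = z
    · by_cases hxw : F x w = z
      · refine ⟨(y, w, x), ?_, ?_⟩
        · exact (List.perm_append_comm (l₁ := [y, w]) (l₂ := [x]))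
        · simp only [NonMono]
          grind
      · refine ⟨(x, w, y), (List.Perm.swap _ _ _).cons _, ?_⟩
        simp only [NonMono]
        grind
    · exact ⟨(x, y, w), List.Perm.refl _, fun h => ⟨h, hxy⟩⟩
  choose o ho ho' using h1
  have hperm : (verts (l.map o)).Perm (verts l) := by
    unfold verts
    rw [List.flatMap_map]
    exact List.Perm.flatMap_left l fun T _ => by simpa using ho T
  refine ⟨l.map o, ⟨⟨?_, hperm.nodup_iff.2 hl.1.2⟩, ?_⟩, by simp, fun v => hperm.mem_iff, ?_⟩
  · intro T hT
    obtain ⟨T₀, hT₀, rfl⟩ := List.mem_map.1 hT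
    exact (ho' T₀ (hl.1.1 T₀ hT₀)).1
  · simpa using hl.2
  · intro T hT
    obtain ⟨T₀, hT₀, rfl⟩ := List.mem_map.1 hT
    exact (ho' T₀ (hl.1.1 T₀ hT₀)).2

lemma IsPacking.take {l : List (W × W × W)} (hl : IsPacking F l) (k : ℕ) :
    IsPacking F (l.take k) := by
  refine ⟨fun T hT => hl.1 T (List.mem_of_mem_take hT), ?_⟩
  have := hl.2
  rw [← List.take_append_drop k l, verts_append] at this
  exact (List.nodup_append.1 this).1

lemma exists_isMaxPacking [Fintype W] (F : W → W → Γ) : ∃ l, IsMaxPacking F l := by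
  have hb : ∀ l, IsPacking F l → l.length ≤ Fintype.card W := by
    intro l hl
    have := hl.2.length_le_card
    rw [length_verts] at this
    omega
  have hne : {m | ∃ l, IsPacking F l ∧ l.length = m}.Nonempty := ⟨0, [], ⟨by simp, by simp⟩, rfl⟩
  have hbdd : BddAbove {m | ∃ l, IsPacking F l ∧ l.length = m} := by
    refine ⟨Fintype.card W, ?_⟩
    rintro _ ⟨l, hl, rfl⟩
    exact hb l hl
  obtain ⟨l, hl, hlen⟩ := Nat.sSup_mem hne hbdd
  exact ⟨l, hl, fun l' hl' => hlen ▸ le_csSup hbdd ⟨l', hl', rfl⟩⟩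

/-- The vertices outside a maximum packing span a monochromatic clique, if there are at least three
of them. -/
lemma IsMaxPacking.exists_color (hF : ∀ u v, F u v = F v u) {l : List (W × W × W)}
    (hl : IsMaxPacking F l) {R : Finset W} (hR : ∀ v, v ∈ R ↔ v ∉ verts l) (h3 : 3 ≤ #R) :
    ∃ z, ∀ u ∈ R, ∀ v ∈ R, u ≠ v → F u v = z := by
  have hmono : ∀ a ∈ R, ∀ b ∈ R, ∀ c ∈ R, a ≠ b → a ≠ c → b ≠ c → F a b = F a c := by
    intro a ha b hb c hc hab hac hbc
    by_contra hne
    rw [hR] at ha hb hc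
    have := hl.2 ((a, b, c) :: l) ⟨?_, ?_⟩
    · simp at this
    · intro T hT
      rcases List.mem_cons.1 hT with rfl | hT
      · exact fun h => hne h.1
      · exact hl.1.1 T hT
    · have := hl.1.2
      simp
      grind
  have hmono' : ∀ a ∈ R, ∀ b ∈ R, ∀ c ∈ R, a ≠ b → a ≠ c → F a b = F a c := by
    intro a ha b hb c hc hab hac
    by_cases hbc : b = c
    · rw [hbc]
    · exact hmono a ha b hb c hc hab hac hbc
  obtain ⟨r, hr, s, hs, hrs⟩ := Finset.one_lt_card.1 (by omega : 1 < #R)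
  refine ⟨F r s, fun u hu v hv huv => ?_⟩
  by_cases hur : u = r
  · subst hur
    exact hmono' u hu v hv s hs huv hrs
  · rw [hmono' u hu v hv r hr huv hur, hF, hmono' r hr u hu s hs (Ne.symm hur) hrs]

/-- If all vertices outside an oriented maximum packing are joined in color `z`, then they and the
last vertices of the triangles together form a clique of color `z`, and the first two vertices of a
triangle are not joined to two different vertices of this clique in colors other than `z`. -/
lemma IsMaxPacking.clique (hF : ∀ u v, F u v = F v u) {l : List (W × W × W)}
    (hl : IsMaxPacking F l) {z : Γ} (hz : ∀ T ∈ l, F T.1 T.2.1 ≠ z) {R : Finset W}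
    (hR : ∀ v, v ∈ R ↔ v ∉ verts l) (h3 : 3 ≤ #R) (hRz : ∀ u ∈ R, ∀ v ∈ R, u ≠ v → F u v = z)
    {u v : W} (hu : u ∈ R ∨ ∃ T ∈ l, u = T.2.2) (hv : v ∈ R ∨ ∃ T ∈ l, v = T.2.2) (huv : u ≠ v) :
    F u v = z ∧ ∀ T ∈ l, ¬ (F T.1 u ≠ z ∧ F T.2.1 v ≠ z) := by
  classical
  have hfree2 : ∀ r ∈ R, ∀ s ∈ R, r ≠ s → ∃ t, FreeTriangle F l z r s t := by
    intro r hr s hs hrs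
    have : #({r, s} : Finset W) < #R := (Finset.card_le_two).trans_lt h3
    obtain ⟨t, ht, ht'⟩ := Finset.exists_mem_notMem_of_card_lt_card this
    simp only [mem_insert, mem_singleton, not_or] at ht'
    refine ⟨t, ?_, ?_, hRz r hr s hs hrs, hRz r hr t ht (Ne.symm ht'.1),
      hRz s hs t ht (Ne.symm ht'.2)⟩
    · simp
      grind
    · simp [← hR, hr, hs, ht]
  have hfree1 : ∀ r ∈ R, ∃ s t, FreeTriangle F l z r s t := by
    intro r hr
    have : #({r} : Finset W) < #R := by
      rw [card_singleton]
      omega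
    obtain ⟨s, hs, hs'⟩ := Finset.exists_mem_notMem_of_card_lt_card this
    exact ⟨s, hfree2 r hr s hs (by grind)⟩
  obtain ⟨r₀, hr₀⟩ : R.Nonempty := Finset.card_pos.1 (by omega)
  obtain ⟨s₀, t₀, h₀⟩ := hfree1 r₀ hr₀
  have hperm1 : ∀ T ∈ l, ∃ l', l.Perm (T :: l') := fun T hT => ⟨_, List.perm_cons_erase hT⟩
  have hperm2 : ∀ T ∈ l, ∀ T' ∈ l, T' ≠ T → ∃ l', l.Perm (T :: T' :: l') := by
    intro T hT T' hT' hne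
    exact ⟨_, (List.perm_cons_erase hT).trans
      ((List.perm_cons_erase ((List.mem_erase_of_ne hne).2 hT')).cons T)⟩
  have hperm3 : ∀ T ∈ l, ∀ T' ∈ l, ∀ T'' ∈ l, T' ≠ T → T'' ≠ T → T'' ≠ T' →
      ∃ l', l.Perm (T :: T' :: T'' :: l') := by
    intro T hT T' hT' T'' hT'' h1 h2 h3
    exact ⟨_, (List.perm_cons_erase hT).trans
      (((List.perm_cons_erase ((List.mem_erase_of_ne h1).2 hT')).trans
        ((List.perm_cons_erase ((List.mem_erase_of_ne h3).2
          ((List.mem_erase_of_ne h2).2 hT''))).cons T')).cons T)⟩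
  constructor
  · rcases hu with hu | ⟨T, hT, rfl⟩ <;> rcases hv with hv | ⟨T', hT', rfl⟩
    · exact hRz u hu v hv huv
    · obtain ⟨s, t, h⟩ := hfree1 u hu
      obtain ⟨l', hl'⟩ := hperm1 T' hT'
      rw [hF]
      exact (hl.perm hl').eq_of_ne hF (hz T' hT') (h.perm hl')
    · obtain ⟨s, t, h⟩ := hfree1 v hv
      obtain ⟨l', hl'⟩ := hperm1 T hT
      exact (hl.perm hl').eq_of_ne hF (hz T hT) (h.perm hl')
    · obtain ⟨l', hl'⟩ := hperm2 T hT T' hT' (by grind)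
      exact (hl.perm hl').opposite_eq hF (hz T hT) (hz T' hT') (h₀.perm hl')
  · rintro T hT ⟨h1, h2⟩
    have hzT := hz T hT
    have hzT' : F T.2.1 T.1 ≠ z := by rwa [hF]
    -- the same packing, with the roles of the first two vertices of `T` exchanged
    have hsw : ∀ {m : List (W × W × W)} {r s t : W}, FreeTriangle F (T :: m) z r s t →
        FreeTriangle F ((T.2.1, T.1, T.2.2) :: m) z r s t := fun h => h.congr (by simp; grind)
    rcases hu with hu | ⟨T', hT', rfl⟩ <;> rcases hv with hv | ⟨T'', hT'', rfl⟩
    · obtain ⟨t, h⟩ := hfree2 u hu v hv huv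
      obtain ⟨l', hl'⟩ := hperm1 T hT
      exact (hl.perm hl').not_ne_and_ne hF (h.perm hl') ⟨h1, h2⟩
    · obtain ⟨s, t, h⟩ := hfree1 u hu
      by_cases hTT : T'' = T
      · subst hTT
        obtain ⟨l', hl'⟩ := hperm1 _ hT
        have hm := ((hl.perm hl').swap_left hF).swap_right hF
        exact h1 (hm.eq_of_ne hF h2 ((h.perm hl').congr (by simp; grind)))
      · obtain ⟨l', hl'⟩ := hperm2 T hT T'' hT'' hTT
        exact ((hl.perm hl').swap_left hF).not_opposite_ne_and_free_ne hF hzT' (hz T'' hT'')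
          (hsw (h.perm hl')) ⟨h2, h1⟩
    · obtain ⟨s, t, h⟩ := hfree1 v hv
      by_cases hTT : T' = T
      · subst hTT
        obtain ⟨l', hl'⟩ := hperm1 _ hT
        have hm := (hl.perm hl').swap_right hF
        exact h2 (hm.eq_of_ne hF h1 ((h.perm hl').congr (by simp; grind)))
      · obtain ⟨l', hl'⟩ := hperm2 T hT T' hT' hTT
        exact (hl.perm hl').not_opposite_ne_and_free_ne hF hzT (hz T' hT')
          (h.perm hl') ⟨h1, h2⟩
    · by_cases hTT : T' = T
      · subst hTT
        obtain ⟨l', hl'⟩ := hperm2 _ hT T'' hT'' (by grind)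
        exact (hl.perm hl').not_own_ne_and_opposite_ne hF hzT (hz T'' hT'')
          (h₀.perm hl') ⟨h1, h2⟩
      · by_cases hTT' : T'' = T
        · subst hTT'
          obtain ⟨l', hl'⟩ := hperm2 _ hT T' hT' (by grind)
          exact ((hl.perm hl').swap_left hF).not_own_ne_and_opposite_ne hF hzT' (hz T' hT')
            (hsw (h₀.perm hl')) ⟨h2, h1⟩
        · obtain ⟨l', hl'⟩ := hperm3 T hT T' hT' T'' hT'' hTT hTT' (by grind)
          exact (hl.perm hl').not_opposite_ne_and_opposite_ne hF hzT (hz T' hT') (hz T'' hT'')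
            (h₀.perm hl') ⟨h1, h2⟩

/-- An edge coloring of a complete graph on at least `3 * k` vertices either has `k` disjoint
non-monochromatic triangles, or becomes almost monochromatic after the deletion of fewer than `k`
vertices: what is left consists of a monochromatic clique `K` and of a set `Y` of fewer than `k`
vertices, each of which is joined to `K`, with at most one exception `a y`, in the color of `K`.
Nothing is said about the edges inside `Y`. -/
theorem exists_packing_or_clique [Fintype W] [DecidableEq W] (hF : ∀ u v, F u v = F v u) {k : ℕ}
    (hk : 1 ≤ k) (hN : 3 * k ≤ Fintype.card W) :
    (∃ l, IsPacking F l ∧ l.length = k) ∨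
    ∃ (z : Γ) (K Y : Finset W) (a : W → W), Disjoint K Y ∧ #Y < k ∧
      #K + 2 * #Y = Fintype.card W ∧ (∀ u ∈ K, ∀ v ∈ K, u ≠ v → F u v = z) ∧
      ∀ y ∈ Y, ∀ u ∈ K, u ≠ a y → F y u = z := by
  classical
  obtain ⟨l₀, hl₀⟩ := exists_isMaxPacking F
  by_cases hlk : k ≤ l₀.length
  · exact Or.inl ⟨l₀.take k, hl₀.1.take k, by simpa using hlk⟩
  right
  push Not at hlk
  have hcardR : ∀ l : List (W × W × W), IsPacking F l →
      #(univ.filter fun v => v ∉ verts l) = Fintype.card W - 3 * l.length := by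
    intro l hl
    rw [← length_verts, ← List.toFinset_card_of_nodup hl.2, ← Finset.card_compl]
    congr 1
    ext v
    simp
  set R := univ.filter fun v => v ∉ verts l₀ with hRdef
  have hR₀ : ∀ v, v ∈ R ↔ v ∉ verts l₀ := fun v => by simp [hRdef]
  have h3 : 3 ≤ #R := by
    rw [hRdef, hcardR l₀ hl₀.1]
    omega
  obtain ⟨z, hz⟩ := hl₀.exists_color hF hR₀ h3
  obtain ⟨l, hl, hlen, hverts, hlz⟩ := hl₀.exists_oriented hF z
  have hR : ∀ v, v ∈ R ↔ v ∉ verts l := fun v => by rw [hR₀, hverts]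
  have hcl := fun {u v} => hl.clique hF hlz hR h3 hz (u := u) (v := v)
  have : Nonempty W := Fintype.card_pos_iff.1 (by omega)
  -- one of the first two vertices of every triangle has at most one exceptional neighbor
  have hch : ∀ T ∈ l, ∃ y a : W, (y = T.1 ∨ y = T.2.1) ∧
      ∀ u, (u ∈ R ∨ ∃ T ∈ l, u = T.2.2) → u ≠ a → F y u = z := by
    intro T hT
    by_cases h : ∃ a, (a ∈ R ∨ ∃ T ∈ l, a = T.2.2) ∧ F T.1 a ≠ z
    · obtain ⟨a, ha, haz⟩ := h
      refine ⟨T.2.1, a, Or.inr rfl, fun u hu hua => ?_⟩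
      by_contra hne
      exact (hcl ha hu (Ne.symm hua)).2 T hT ⟨haz, hne⟩
    · push Not at h
      exact ⟨T.1, T.1, Or.inl rfl, fun u hu _ => h u hu⟩
  choose! y a hy ha using hch
  have hmemy : ∀ T ∈ l, y T ∈ verts [T] := by
    intro T hT
    simp
    grind
  have hyinj : Set.InjOn y (l.toFinset : Set (W × W × W)) := by
    intro T hT T' hT' h
    simp only [List.coe_toFinset, Set.mem_ofPred_eq] at hT hT'
    exact hl.1.eq_of_mem hT hT' (hmemy T hT) (h ▸ hmemy T' hT')
  have hne : ∀ T ∈ l, T.1 ≠ T.2.1 ∧ T.1 ≠ T.2.2 ∧ T.2.1 ≠ T.2.2 := by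
    intro T hT
    have := (hl.1.perm (List.perm_cons_erase hT)).2
    simp at this
    grind
  have hlcard : #l.toFinset = l.length := List.toFinset_card_of_nodup hl.1.nodup
  set E := l.toFinset.image (fun T => T.1) ∪ l.toFinset.image (fun T => T.2.1) with hE
  have hEcard : #E = 2 * l.length := by
    rw [hE, Finset.card_union_of_disjoint, Finset.card_image_of_injOn, Finset.card_image_of_injOn,
      hlcard, two_mul]
    · intro T hT T' hT' h
      simp only [List.coe_toFinset, Set.mem_ofPred_eq] at hT hT' h
      exact hl.1.eq_of_mem (v := T.2.1) hT hT' (by simp) (by simp [h])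
    · intro T hT T' hT' h
      simp only [List.coe_toFinset, Set.mem_ofPred_eq] at hT hT' h
      exact hl.1.eq_of_mem (v := T.1) hT hT' (by simp) (by simp [h])
    · rw [Finset.disjoint_left]
      intro v hv hv'
      obtain ⟨T, hT, rfl⟩ := mem_image.1 hv
      obtain ⟨T', hT', h⟩ := mem_image.1 hv'
      rw [List.mem_toFinset] at hT hT'
      have : T' = T := hl.1.eq_of_mem (v := T.1) hT' hT (by simp [h]) (by simp)
      subst this
      exact (hne _ hT).1 h.symm
  have hK : ∀ v, v ∈ Eᶜ → v ∈ R ∨ ∃ T ∈ l, v = T.2.2 := by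
    intro v hv
    by_contra! h
    rw [hR, not_not, mem_verts] at h
    obtain ⟨⟨T, hT, hvT⟩, h⟩ := h
    have := h T hT
    simp only [hE, mem_compl, mem_union, mem_image, List.mem_toFinset, not_or, not_exists,
      not_and] at hv
    have h1 := hv.1 T hT
    have h2 := hv.2 T hT
    grind
  have hY : ∀ v ∈ l.toFinset.image y, ∃ a, ∀ u ∈ Eᶜ, u ≠ a → F v u = z := by
    intro v hv
    obtain ⟨T, hT, rfl⟩ := mem_image.1 hv
    rw [List.mem_toFinset] at hT
    exact ⟨a T, fun u hu hua => ha T hT u (hK u hu) hua⟩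
  choose! b hb using hY
  have hcardY : #(l.toFinset.image y) = l.length := by
    rw [Finset.card_image_of_injOn hyinj, hlcard]
  refine ⟨z, Eᶜ, l.toFinset.image y, b, ?_, ?_, ?_, ?_, hb⟩
  · rw [Finset.disjoint_left]
    intro v hv hv'
    obtain ⟨T, hT, rfl⟩ := mem_image.1 hv'
    rw [List.mem_toFinset] at hT
    refine (mem_compl.1 hv) ?_
    rcases hy T hT with h | h
    · exact mem_union_left _ (mem_image.2 ⟨T, by simpa using hT, h.symm⟩)
    · exact mem_union_right _ (mem_image.2 ⟨T, by simpa using hT, h.symm⟩)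
  · rw [hcardY, hlen]
    exact hlk
  · have := Finset.card_le_univ E
    rw [hcardY, Finset.card_compl, hEcard]
    omega
  · exact fun u hu v hv huv => (hcl (hK u hu) (hK v hv) huv).1

end Structure

/-! ### Monochromatic copies in almost monochromatic colorings -/

section TwoPacking

variable {V : Type*} {G : SimpleGraph V} {S : Finset V}

lemma IsTwoPacking.eq_of_common (hS : IsTwoPacking G S) {u v x : V} (hu : u ∈ S) (hv : v ∈ S)
    (hux : x = u ∨ G.Adj u x) (hvx : x = v ∨ G.Adj v x) : u = v := by
  by_contra hne
  have h := hS u hu v hv hne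
  have : x ∈ closedNeighborSet G u ∩ closedNeighborSet G v := by
    simp only [closedNeighborSet, Set.mem_inter_iff, Set.mem_union, SimpleGraph.mem_neighborSet,
      Set.mem_singleton_iff]
    exact ⟨hux.symm, hvx.symm⟩
  rw [h] at this
  exact this

lemma IsTwoPacking.not_adj (hS : IsTwoPacking G S) {u v : V} (hu : u ∈ S) (hv : v ∈ S) :
    ¬ G.Adj u v := by
  intro h
  exact h.ne (hS.eq_of_common hu hv (Or.inr h) (Or.inl rfl))

end TwoPacking

/-- If each `y ∈ Y` is joined to the clique `K` in the color of `K`, with `a y` as the only possible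
exception, then a graph with a 2-packing at least as large as `Y` has a monochromatic copy in
`K ∪ Y`, provided that this set has more vertices than the graph: the
vertices of `Y` are used for the 2-packing, so no edge inside `Y` is used, and whenever `a y` is
used for a neighbor of the vertex at `y`, this neighbor can be moved to an unused vertex of `K`. -/
theorem exists_mono_copy {V W Γ : Type*} [Fintype V] [DecidableEq V] [DecidableEq W]
    {G : SimpleGraph V} {S : Finset V} (hS : IsTwoPacking G S) {F : W → W → Γ}
    (hF : ∀ u v, F u v = F v u) {z : Γ} {K Y : Finset W} {a : W → W} (hKY : Disjoint K Y)
    (hYS : #Y ≤ #S) (hcard : Fintype.card V < #K + #Y)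
    (hK : ∀ u ∈ K, ∀ v ∈ K, u ≠ v → F u v = z)
    (hY : ∀ y ∈ Y, ∀ u ∈ K, u ≠ a y → F y u = z) :
    ∃ φ : V → W, Function.Injective φ ∧ ∀ u v, G.Adj u v → F (φ u) (φ v) = z := by
  classical
  obtain ⟨S₀, hS₀, hS₀card⟩ := Finset.exists_subset_card_eq hYS
  let P : (V → W) → Prop := fun φ =>
    Function.Injective φ ∧ (∀ v ∈ S₀, φ v ∈ Y) ∧ ∀ v ∉ S₀, φ v ∈ K
  let bad : (V → W) → Finset V := fun φ => S₀.filter fun v => ∃ u, G.Adj v u ∧ φ u = a (φ v)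
  have hex : ∃ φ, P φ := by
    let e := Finset.equivOfCardEq hS₀card
    have hW : Nonempty W := by
      have : 0 < #K + #Y := by omega
      rcases Nat.eq_zero_or_pos #K with h | h
      · obtain ⟨w, -⟩ := Finset.card_pos.1 (by omega : 0 < #Y)
        exact ⟨w⟩
      · obtain ⟨w, -⟩ := Finset.card_pos.1 h
        exact ⟨w⟩
    let f : V → W := fun v => if h : v ∈ S₀ then e ⟨v, h⟩ else hW.some
    have hf : ∀ v (h : v ∈ S₀), f v = e ⟨v, h⟩ := fun v h => by simp [f, h]
    obtain ⟨φ, hφ, hφf, hφT⟩ := exists_injective_extension S₀ (K ∪ Y) f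
      (by
        intro u hu v hv huv
        rw [hf u hu, hf v hv] at huv
        simpa using e.injective (Subtype.ext huv))
      (by
        intro v hv
        rw [hf v hv]
        exact mem_union_right _ (e _).2)
      (by
        rw [Finset.card_union_of_disjoint hKY]
        omega)
    refine ⟨φ, hφ, ?_, ?_⟩
    · intro v hv
      rw [hφf v hv, hf v hv]
      exact (e _).2
    · intro v hv
      refine (mem_union.1 (hφT v)).resolve_right fun h => hv ?_
      have h1 : φ (e.symm ⟨φ v, h⟩) = φ v := by
        rw [hφf _ (e.symm ⟨φ v, h⟩).2, hf _ (e.symm ⟨φ v, h⟩).2]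
        simp
      rw [← hφ h1]
      exact (e.symm ⟨φ v, h⟩).2
  -- choose `φ` with the least number of conflicts
  have hex' : ∃ m, ∃ φ, P φ ∧ #(bad φ) = m := by
    obtain ⟨φ, hφ⟩ := hex
    exact ⟨_, φ, hφ, rfl⟩
  obtain ⟨φ, ⟨hinj, hφY, hφK⟩, hφm⟩ := Nat.find_spec hex'
  have hmin : ∀ ψ, P ψ → #(bad φ) ≤ #(bad ψ) := fun ψ hψ =>
    hφm ▸ Nat.find_min' hex' ⟨ψ, hψ, rfl⟩
  have hbad : ∀ v ∈ S₀, ∀ u, G.Adj v u → φ u ≠ a (φ v) := by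
    intro v hv u hvu hau
    have huS : u ∉ S₀ := fun h => hS.not_adj (hS₀ hv) (hS₀ h) hvu
    obtain ⟨w, hwK, hw⟩ : ∃ w ∈ K, w ∉ (S₀ᶜ).image φ := by
      refine Finset.exists_mem_notMem_of_card_lt_card ?_
      have := Finset.card_le_univ S₀
      rw [Finset.card_image_of_injective _ hinj, Finset.card_compl]
      omega
    have hw' : ∀ x, φ x ≠ w := by
      intro x hx
      by_cases hxS : x ∈ S₀
      · exact Finset.disjoint_left.1 hKY hwK (hx ▸ hφY x hxS)
      · exact hw (mem_image.2 ⟨x, by simpa using hxS, hx⟩)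
    have hlt : #(bad (Function.update φ u w)) < #(bad φ) := by
      refine Finset.card_lt_card ((Finset.ssubset_iff_of_subset ?_).2 ⟨v, ?_, ?_⟩)
      · intro x hx
        obtain ⟨hxS, u', hxu', hu'⟩ := mem_filter.1 hx
        have hxu : x ≠ u := fun h => huS (h ▸ hxS)
        rw [Function.update_of_ne hxu] at hu'
        by_cases huu : u' = u
        · subst huu
          rw [Function.update_self] at hu'
          have : x = v := hS.eq_of_common (hS₀ hxS) (hS₀ hv) (Or.inr hxu') (Or.inr hvu)
          subst this
          exact absurd (hau.trans hu'.symm) (hw' _)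
        · rw [Function.update_of_ne huu] at hu'
          exact mem_filter.2 ⟨hxS, u', hxu', hu'⟩
      · exact mem_filter.2 ⟨hv, u, hvu, hau⟩
      · intro hx
        obtain ⟨-, u', hxu', hu'⟩ := mem_filter.1 hx
        have hxu : v ≠ u := fun h => huS (h ▸ hv)
        rw [Function.update_of_ne hxu] at hu'
        by_cases huu : u' = u
        · subst huu
          rw [Function.update_self] at hu'
          exact hw' _ (hau.trans hu'.symm)
        · rw [Function.update_of_ne huu] at hu'
          exact huu (hinj (hu'.trans hau.symm))
    refine absurd (hmin (Function.update φ u w) ⟨?_, ?_, ?_⟩) (not_le.2 hlt)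
    · intro x y hxy
      by_cases hx : x = u <;> by_cases hy : y = u
      · rw [hx, hy]
      · subst hx
        rw [Function.update_self, Function.update_of_ne hy] at hxy
        exact absurd hxy.symm (hw' _)
      · subst hy
        rw [Function.update_self, Function.update_of_ne hx] at hxy
        exact absurd hxy (hw' _)
      · rw [Function.update_of_ne hx, Function.update_of_ne hy] at hxy
        exact hinj hxy
    · intro x hx
      rw [Function.update_of_ne fun h : x = u => huS (h ▸ hx)]
      exact hφY x hx
    · intro x hx
      by_cases hxu : x = u
      · subst hxu
        rwa [Function.update_self]
      · rw [Function.update_of_ne hxu]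
        exact hφK x hx
  refine ⟨φ, hinj, fun u v huv => ?_⟩
  by_cases hu : u ∈ S₀
  · have hv : v ∉ S₀ := fun h => hS.not_adj (hS₀ hu) (hS₀ h) huv
    exact hY _ (hφY u hu) _ (hφK v hv) (hbad u hu v huv)
  · by_cases hv : v ∈ S₀
    · rw [hF]
      exact hY _ (hφY v hv) _ (hφK u hu) (hbad v hv u huv.symm)
    · exact hK _ (hφK u hu) _ (hφK v hv) (hinj.ne huv.ne)

/-! ### Switches -/

section Switch

variable {W Γ : Type*} [DecidableEq W] [AddCommGroup Γ]

/-- A set `U` of `d + 2` vertices is a switch of degree `d` if it consists of two vertices `a`, `b`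
and of a set `D` of size `d` such that the stars from `a` and from `b` to `D` have different
sums. -/
def IsSwitch (F : W → W → Γ) (d : ℕ) (U : Finset W) : Prop :=
  ∃ (a b : W) (D : Finset W), a ≠ b ∧ a ∉ D ∧ b ∉ D ∧ #D = d ∧ U = insert a (insert b D) ∧
    ∑ w ∈ D, F a w ≠ ∑ w ∈ D, F b w

lemma IsSwitch.card {F : W → W → Γ} {d : ℕ} {U : Finset W} (h : IsSwitch F d U) : #U = d + 2 := by
  obtain ⟨a, b, D, hab, ha, hb, hD, rfl, -⟩ := h
  rw [card_insert_of_notMem (by simp [hab, ha]), card_insert_of_notMem hb, hD]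

/-- A pair of edges `aw`, `bw` of different colors extends to a switch of degree `d`, if `d` is not
divisible by `p`: otherwise all differences `F a u - F b u` would be equal and their multiple by `d`
would vanish. For `d = 1` no extension is needed. -/
lemma exists_isSwitch_of_ne {p : ℕ} [Fact p.Prime] {F : W → W → ZMod p} {a b w : W}
    (hab : a ≠ b) (haw : a ≠ w) (hbw : b ≠ w) (h : F a w ≠ F b w) {d : ℕ} (hd : (d : ZMod p) ≠ 0)
    {P : Finset W} (hP : Disjoint P {a, b, w}) (hPd : d ≤ #P ∨ d = 1) :
    ∃ U ⊆ {a, b, w} ∪ P, IsSwitch F d U := by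
  by_contra! hno
  have haP : a ∉ P := fun h => Finset.disjoint_left.1 hP h (by simp)
  have hbP : b ∉ P := fun h => Finset.disjoint_left.1 hP h (by simp)
  have hwP : w ∉ P := fun h => Finset.disjoint_left.1 hP h (by simp)
  have hzero : ∀ D ⊆ insert w P, #D = d → ∑ u ∈ D, (F a u - F b u) = 0 := by
    intro D hD hDd
    by_contra hne
    rw [Finset.sum_sub_distrib, sub_eq_zero] at hne
    refine hno (insert a (insert b D)) ?_ ⟨a, b, D, hab, ?_, ?_, hDd, rfl, hne⟩
    · intro x hx
      have := @hD x
      simp at hx this ⊢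
      tauto
    · intro haD
      have := hD haD
      simp [haw, haP] at this
    · intro hbD
      have := hD hbD
      simp [hbw, hbP] at this
  have hg : F a w - F b w ≠ 0 := sub_ne_zero.2 h
  by_cases hd1 : d = 1
  · exact hg (by simpa using hzero {w} (by simp) (by simp [hd1]))
  have hPd : d ≤ #P := hPd.resolve_right hd1
  have hd0 : d ≠ 0 := by
    rintro rfl
    simp at hd
  have heq : ∀ u ∈ P, F a u - F b u = F a w - F b w := by
    intro u hu
    obtain ⟨D, hD, hDd⟩ := Finset.exists_subset_card_eq (s := P.erase u) (n := d - 1)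
      (by rw [card_erase_of_mem hu]; omega)
    have huD : u ∉ D := fun h => by simpa using hD h
    have hDP : D ⊆ P := hD.trans (erase_subset _ _)
    have hwD : w ∉ D := fun h => hwP (hDP h)
    have h1 := hzero (insert u D) (by
      intro x hx
      rcases mem_insert.1 hx with rfl | hx
      · exact mem_insert_of_mem hu
      · exact mem_insert_of_mem (hDP hx)) (by rw [card_insert_of_notMem huD]; omega)
    have h2 := hzero (insert w D) (insert_subset_insert _ hDP)
      (by rw [card_insert_of_notMem hwD]; omega)
    rw [sum_insert huD] at h1
    rw [sum_insert hwD] at h2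
    exact add_right_cancel (h1.trans h2.symm)
  obtain ⟨D, hD, hDd⟩ := Finset.exists_subset_card_eq hPd
  have h1 := hzero D (hD.trans (subset_insert _ _)) hDd
  rw [Finset.sum_congr rfl fun u hu => heq u (hD hu), sum_const, hDd, nsmul_eq_mul] at h1
  exact (mul_ne_zero hd hg) h1

/-- If the differences `F a w - F b w` and `F a w' - F b w'` are different, then `a` and `b` extend
to a switch of any positive degree. -/
lemma exists_isSwitch_of_sub_ne {F : W → W → Γ} {a b w w' : W}
    (hnd : [a, b, w, w'].Nodup) (h : F a w - F b w ≠ F a w' - F b w') {d : ℕ} (hd : 1 ≤ d)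
    {P : Finset W} (hP : Disjoint P {a, b, w, w'}) (hPd : d - 1 ≤ #P) :
    ∃ U ⊆ {a, b, w, w'} ∪ P, IsSwitch F d U := by
  by_contra! hno
  simp at hnd
  obtain ⟨D, hD, hDd⟩ := Finset.exists_subset_card_eq hPd
  have hnot : ∀ x ∈ ({a, b, w, w'} : Finset W), x ∉ D := fun x hx hxD =>
    Finset.disjoint_left.1 hP (hD hxD) hx
  have haD := hnot a (by simp)
  have hbD := hnot b (by simp)
  have key : ∀ x, x ∉ D → a ≠ x → b ≠ x → x ∈ ({a, b, w, w'} : Finset W) →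
      F a x - F b x + ∑ u ∈ D, (F a u - F b u) = 0 := by
    intro x hxD hax hbx hx
    by_contra hne
    have hsum : ∑ u ∈ insert x D, (F a u - F b u) =
        F a x - F b x + ∑ u ∈ D, (F a u - F b u) := Finset.sum_insert hxD
    rw [← hsum, Finset.sum_sub_distrib, sub_eq_zero] at hne
    refine hno (insert a (insert b (insert x D))) ?_
      ⟨a, b, insert x D, hnd.1.1, by simp [hax, haD], by simp [hbx, hbD], ?_, rfl, hne⟩
    · intro y hy
      have := @hD y
      simp at hx hy this ⊢
      grind
    · rw [card_insert_of_notMem hxD]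
      omega
  have h1 := key w (hnot w (by simp)) (by tauto) (by tauto) (by simp)
  have h2 := key w' (hnot w' (by simp)) (by tauto) (by tauto) (by simp)
  exact h (add_right_cancel (h1.trans h2.symm))

end Switch

/-- Disjoint seeds `X v` are extended greedily to disjoint sets `U v` of size `s v` with property
`Q v`, if every seed can be extended inside any set of `m v` unused elements. -/
lemma exists_disjoint_extension {V W : Type*} [DecidableEq V] [Fintype W] [DecidableEq W]
    (S : Finset V) (X : V → Finset W) (hX : (S : Set V).PairwiseDisjoint X)
    (Q : V → Finset W → Prop) (m s : V → ℕ) (hQs : ∀ v U, Q v U → #U = s v)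
    (hext : ∀ v ∈ S, ∀ P : Finset W, Disjoint P (X v) → m v ≤ #P → ∃ U ⊆ X v ∪ P, Q v U)
    (hcount : ∀ v ∈ S, ∀ A ⊆ S, v ∉ A →
      ∑ u ∈ A, s u + ∑ u ∈ S \ A, #(X u) + m v ≤ Fintype.card W) :
    ∃ U : V → Finset W, (∀ v ∈ S, Q v (U v)) ∧ (S : Set V).PairwiseDisjoint U := by
  have key : ∀ A : Finset V, A ⊆ S → ∃ U : V → Finset W, (∀ v ∈ A, Q v (U v)) ∧
      (∀ v ∈ S \ A, U v = X v) ∧ (S : Set V).PairwiseDisjoint U := by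
    intro A
    induction A using Finset.induction_on with
    | empty => exact fun _ => ⟨X, by simp, by simp, hX⟩
    | insert v A hvA ih =>
      intro hA
      have hvS : v ∈ S := hA (mem_insert_self v A)
      have hAS : A ⊆ S := (subset_insert v A).trans hA
      obtain ⟨U, hUQ, hUX, hUd⟩ := ih hAS
      have hUv : U v = X v := hUX v (mem_sdiff.2 ⟨hvS, hvA⟩)
      have hcard : #(S.biUnion U) = ∑ u ∈ A, s u + ∑ u ∈ S \ A, #(X u) := by
        rw [Finset.card_biUnion hUd, ← Finset.sum_sdiff hAS, add_comm]
        congr 1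
        · exact Finset.sum_congr rfl fun u hu => hQs u _ (hUQ u hu)
        · exact Finset.sum_congr rfl fun u hu => by rw [hUX u hu]
      have hP : m v ≤ #(S.biUnion U)ᶜ := by
        have := hcount v hvS A hAS hvA
        rw [Finset.card_compl, hcard]
        omega
      have hdisj : Disjoint (S.biUnion U)ᶜ (X v) := by
        rw [Finset.disjoint_left]
        intro x hx hxv
        exact (mem_compl.1 hx) (mem_biUnion.2 ⟨v, hvS, hUv ▸ hxv⟩)
      obtain ⟨U', hU', hQ'⟩ := hext v hvS _ hdisj hP
      have hnew : ∀ u ∈ S, u ≠ v → Disjoint U' (U u) := by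
        intro u hu huv
        rw [Finset.disjoint_left]
        intro x hx hxu
        rcases mem_union.1 (hU' hx) with h | h
        · exact Finset.disjoint_left.1 (hUd hu hvS huv) hxu (hUv ▸ h)
        · exact (mem_compl.1 h) (mem_biUnion.2 ⟨u, hu, hxu⟩)
      refine ⟨Function.update U v U', ?_, ?_, ?_⟩
      · intro u hu
        by_cases huv : u = v
        · subst huv
          rwa [Function.update_self]
        · rw [Function.update_of_ne huv]
          exact hUQ u ((mem_insert.1 hu).resolve_left huv)
      · intro u hu
        simp only [mem_sdiff, mem_insert, not_or] at hu
        rw [Function.update_of_ne hu.2.1]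
        exact hUX u (mem_sdiff.2 ⟨hu.1, hu.2.2⟩)
      · intro u hu u' hu' huu
        simp only [Function.onFun]
        by_cases h : u = v
        · subst h
          rw [Function.update_self, Function.update_of_ne (Ne.symm huu)]
          exact hnew u' hu' (Ne.symm huu)
        · by_cases h' : u' = v
          · subst h'
            rw [Function.update_self, Function.update_of_ne huu]
            exact (hnew u hu huu).symm
          · rw [Function.update_of_ne h, Function.update_of_ne h']
            exact hUd hu hu' huu
  obtain ⟨U, hU, -, hUd⟩ := key S Subset.rfl
  exact ⟨U, hU, hUd⟩

/-- Pairwise disjoint switches of the degrees of the vertices of a 2-packing of size `p - 1` yield a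
zero-sum copy: each vertex `v` of the 2-packing can be placed at either of the two centers of its
switch independently of the others, and by the Cauchy–Davenport theorem the sums of the resulting
copies take all values. -/
theorem exists_zero_sum_of_switches {V W : Type*} [Fintype V] [DecidableEq V] [Fintype W]
    [DecidableEq W] {p : ℕ} (hp : p.Prime) {G : SimpleGraph V} [DecidableRel G.Adj] {S : Finset V}
    (hS : IsTwoPacking G S) (hcard : p - 1 ≤ #S) (c : Sym2 W → ZMod p) {U : V → Finset W}
    (hU : ∀ v ∈ S, IsSwitch (fun x y => c s(x, y)) (G.degree v) (U v))
    (hUd : (S : Set V).PairwiseDisjoint U) (hN : Fintype.card V + #S ≤ Fintype.card W) :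
    ∃ φ : V → W, Function.Injective φ ∧ ∑ e ∈ G.edgeFinset, c (e.map φ) = 0 := by
  classical
  have hSpos : 0 < #S := by
    have := hp.two_le
    omega
  have hW : Nonempty W := Fintype.card_pos_iff.1 (by omega)
  choose! a b D hab ha hb hD hUeq hne using hU
  have hDU : ∀ v ∈ S, ∀ w ∈ D v, w ∈ U v := by
    intro v hv w hw
    rw [hUeq v hv]
    simp [hw]
  have haU : ∀ v ∈ S, a v ∈ U v := by
    intro v hv
    rw [hUeq v hv]
    simp
  have hbU : ∀ v ∈ S, b v ∈ U v := by
    intro v hv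
    rw [hUeq v hv]
    simp
  have hUeq' : ∀ u ∈ S, ∀ v ∈ S, ∀ w, w ∈ U u → w ∈ U v → u = v := by
    intro u hu v hv w hwu hwv
    by_contra huv
    exact Finset.disjoint_left.1 (hUd hu hv huv) hwu hwv
  have hE : ∀ v ∈ S, ∃ f : V → W, Set.InjOn f (G.neighborFinset v) ∧
      ∀ u ∈ G.neighborFinset v, f u ∈ D v := by
    intro v hv
    have hc : #(G.neighborFinset v) = #(D v) := by
      rw [hD v hv, SimpleGraph.card_neighborFinset_eq_degree]
    let e := Finset.equivOfCardEq hc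
    refine ⟨fun u => if h : u ∈ G.neighborFinset v then e ⟨u, h⟩ else hW.some, ?_, ?_⟩
    · intro x hx y hy hxy
      have hx' : x ∈ G.neighborFinset v := hx
      have hy' : y ∈ G.neighborFinset v := hy
      simp only [hx', hy', dite_true] at hxy
      simpa using e.injective (Subtype.ext hxy)
    · intro u hu
      simp only [hu, dite_true]
      exact (e _).2
  choose! E hEinj hED using hE
  -- the vertex of `S` to whose closed neighborhood `u` belongs
  let own : V → V := fun u =>
    if u ∈ S then u else if h : ∃ v ∈ S, G.Adj v u then h.choose else u
  let f : V → W := fun u => if u ∈ S then a u else E (own u) u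
  let dom : Finset V := univ.filter fun u => u ∈ S ∨ ∃ v ∈ S, G.Adj v u
  have hdomS : ∀ v ∈ S, v ∈ dom := fun v hv => by simp [dom, hv]
  have hdomN : ∀ v ∈ S, ∀ u, G.Adj v u → u ∈ dom := fun v hv u huv => by
    simp only [dom, mem_filter, mem_univ, true_and]
    exact Or.inr ⟨v, hv, huv⟩
  have hfS : ∀ v ∈ S, f v = a v := fun v hv => by simp [f, hv]
  have hnS : ∀ v ∈ S, ∀ u, G.Adj v u → u ∉ S := fun v hv u huv hu => hS.not_adj hv hu huv
  have hfN : ∀ v ∈ S, ∀ u, G.Adj v u → f u = E v u := by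
    intro v hv u huv
    have hu := hnS v hv u huv
    have hex : ∃ v ∈ S, G.Adj v u := ⟨v, hv, huv⟩
    have : hex.choose = v :=
      hS.eq_of_common hex.choose_spec.1 hv (Or.inr hex.choose_spec.2) (Or.inr huv)
    simp only [f, own, hu, if_false, dif_pos hex, this]
  have hfND : ∀ v ∈ S, ∀ u, G.Adj v u → f u ∈ D v := by
    intro v hv u huv
    rw [hfN v hv u huv]
    exact hED v hv u (by simpa using huv)
  have hdom : ∀ u ∈ dom, u ∈ S ∨ ∃ v ∈ S, G.Adj v u := fun u hu => by simpa [dom] using hu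
  obtain ⟨φ, hφ, hφf, hφT⟩ := exists_injective_extension dom (univ \ S.image b) f
    (by
      intro x hx y hy hxy
      rcases hdom x hx with hxS | ⟨v, hv, hvx⟩ <;> rcases hdom y hy with hyS | ⟨v', hv', hvy⟩
      · rw [hfS x hxS, hfS y hyS] at hxy
        exact hUeq' x hxS y hyS _ (haU x hxS) (hxy ▸ haU y hyS)
      · have h1 := hfND v' hv' y hvy
        rw [← hxy, hfS x hxS] at h1
        have : x = v' := hUeq' x hxS v' hv' _ (haU x hxS) (hDU v' hv' _ h1)
        subst this
        exact absurd h1 (ha x hxS)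
      · have h1 := hfND v hv x hvx
        rw [hxy, hfS y hyS] at h1
        have : y = v := hUeq' y hyS v hv _ (haU y hyS) (hDU v hv _ h1)
        subst this
        exact absurd h1 (ha y hyS)
      · have h1 := hfND v hv x hvx
        have h2 := hfND v' hv' y hvy
        rw [hxy] at h1
        have : v = v' := hUeq' v hv v' hv' _ (hDU v hv _ h1) (hDU v' hv' _ h2)
        subst this
        rw [hfN v hv x hvx, hfN v hv y hvy] at hxy
        exact hEinj v hv (by simpa using hvx) (by simpa using hvy) hxy)
    (by
      intro x hx
      rw [mem_sdiff]
      refine ⟨mem_univ _, fun h => ?_⟩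
      obtain ⟨v, hv, hbv⟩ := mem_image.1 h
      rcases hdom x hx with hxS | ⟨v', hv', hvx⟩
      · rw [hfS x hxS] at hbv
        have : v = x := hUeq' v hv x hxS _ (hbU v hv) (hbv ▸ haU x hxS)
        subst this
        exact hab v hv hbv.symm
      · have h1 := hfND v' hv' x hvx
        rw [← hbv] at h1
        have : v = v' := hUeq' v hv v' hv' _ (hbU v hv) (hDU v' hv' _ h1)
        subst this
        exact hb v hv h1)
    (by
      have h1 : #(S.image b) ≤ #S := card_image_le
      have h2 := Finset.le_card_sdiff (S.image b) (univ : Finset W)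
      rw [card_univ] at h2
      omega)
  have hφb : ∀ v ∈ S, ∀ x, φ x ≠ b v := by
    intro v hv x h
    exact (mem_sdiff.1 (hφT x)).2 (h ▸ mem_image_of_mem b hv)
  have hφa : ∀ v ∈ S, φ v = a v := fun v hv => by rw [hφf v (hdomS v hv), hfS v hv]
  have himg : ∀ v ∈ S, (G.neighborFinset v).image φ = D v := by
    intro v hv
    refine Finset.eq_of_subset_of_card_le ?_ ?_
    · intro w hw
      obtain ⟨u, hu, rfl⟩ := mem_image.1 hw
      rw [SimpleGraph.mem_neighborFinset] at hu
      rw [hφf u (hdomN v hv u hu)]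
      exact hfND v hv u hu
    · rw [card_image_of_injective _ hφ, hD v hv, SimpleGraph.card_neighborFinset_eq_degree]
  -- choose the centers of the switches
  obtain ⟨g, hg, hgsum⟩ := exists_choice_sum_eq hp S
    (fun v => {∑ w ∈ D v, c s(a v, w), ∑ w ∈ D v, c s(b v, w)})
    (fun v _ => ⟨_, mem_insert_self _ _⟩)
    (by
      rw [Finset.sum_congr rfl fun v hv => by rw [card_pair (hne v hv)]]
      simp
      omega)
    (-∑ e ∈ G.edgeFinset with ∀ v ∈ S, v ∉ e, c (e.map φ))
  let ψ : V → W := fun v => if v ∈ S ∧ g v ≠ ∑ w ∈ D v, c s(a v, w) then b v else φ v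
  have hψ : ∀ v, v ∉ S → ψ v = φ v := fun v hv => by simp [ψ, hv]
  have hψg : ∀ v ∈ S, ∑ w ∈ D v, c s(ψ v, w) = g v := by
    intro v hv
    by_cases h : g v = ∑ w ∈ D v, c s(a v, w)
    · have : ψ v = a v := by simp [ψ, ← h, hφa v hv]
      rw [this, h]
    · have : ψ v = b v := by simp only [ψ, hv, ne_eq, h, not_false_eq_true, and_self, if_true]
      rw [this]
      have := hg v hv
      simp only [mem_insert, mem_singleton] at this
      exact (this.resolve_left h).symm
  refine ⟨ψ, ?_, ?_⟩
  · intro x y hxy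
    simp only [ψ] at hxy
    split_ifs at hxy with hx hy hy
    · exact hUeq' x hx.1 y hy.1 _ (hbU x hx.1) (hxy ▸ hbU y hy.1)
    · exact absurd hxy.symm (hφb x hx.1 y)
    · exact absurd hxy (hφb y hy.1 x)
    · exact hφ hxy
  · rw [sum_edgeFinset_eq_add_sum_stars G (fun e => c (e.map ψ)) S fun u hu v hv => hS.not_adj hu hv]
    have h1 : ∑ e ∈ G.edgeFinset with ∀ v ∈ S, v ∉ e, c (e.map ψ) =
        ∑ e ∈ G.edgeFinset with ∀ v ∈ S, v ∉ e, c (e.map φ) := by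
      refine Finset.sum_congr rfl fun e he => ?_
      have he' := (mem_filter.1 he).2
      congr 1
      refine Sym2.map_congr fun x hx => hψ x fun hxS => he' x hxS hx
    have h2 : ∑ v ∈ S, ∑ u ∈ G.neighborFinset v, c (s(v, u).map ψ) = ∑ v ∈ S, g v := by
      refine Finset.sum_congr rfl fun v hv => ?_
      rw [← hψg v hv, ← himg v hv, Finset.sum_image hφ.injOn]
      refine Finset.sum_congr rfl fun u hu => ?_
      rw [SimpleGraph.mem_neighborFinset] at hu
      rw [Sym2.map_mk, hψ u (hnS v hv u hu)]
    rw [h1, h2, hgsum, add_neg_cancel]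

/-! ### Additive colorings -/

/-- A coloring is of the form `h u + h v + C`, if the difference of the colors of `xw` and `yw` never
depends on `w`. -/
lemma exists_additive {W Γ : Type*} [DecidableEq W] [AddCommGroup Γ] {F : W → W → Γ}
    (hF : ∀ u v, F u v = F v u) {R : Finset W} (hR : 4 ≤ #R)
    (h : ∀ x ∈ R, ∀ y ∈ R, ∀ w ∈ R, ∀ w' ∈ R, [x, y, w, w'].Nodup →
      F x w - F y w = F x w' - F y w') :
    ∃ (g : W → Γ) (C : Γ), ∀ u ∈ R, ∀ v ∈ R, u ≠ v → F u v = g u + g v + C := by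
  obtain ⟨z, hz⟩ : R.Nonempty := Finset.card_pos.1 (by omega)
  have hex : ∀ x ∈ R, ∃ w ∈ R, w ≠ x ∧ w ≠ z := by
    intro x hx
    have : #({x, z} : Finset W) < #R := (Finset.card_le_two).trans_lt (by omega)
    obtain ⟨t, ht, ht'⟩ := Finset.exists_mem_notMem_of_card_lt_card this
    simp only [mem_insert, mem_singleton, not_or] at ht'
    exact ⟨t, ht, ht'⟩
  have : Nonempty W := ⟨z⟩
  choose! w hw hwx hwz using hex
  have hdiff : ∀ x ∈ R, x ≠ z → ∀ y ∈ R, y ≠ z → x ≠ y →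
      F x y = F z y + (F x (w x) - F z (w x)) := by
    intro x hx hxz y hy hyz hxy
    rw [← sub_eq_iff_eq_add']
    by_cases hyw : y = w x
    · rw [← hyw]
    · refine h x hx z hz y hy (w x) (hw x hx) ?_
      have h1 := hwx x hx
      have h2 := hwz x hx
      simp
      grind
  obtain ⟨x₀, hx₀, -, hx₀z⟩ : ∃ x₀ ∈ R, x₀ ≠ z ∧ x₀ ≠ z := ⟨w z, hw z hz, hwz z hz, hwz z hz⟩
  refine ⟨fun x => if x = z then 0 else F x (w x) - F z (w x),
    F z x₀ - (F x₀ (w x₀) - F z (w x₀)), ?_⟩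
  have hzx : ∀ y ∈ R, y ≠ z → F z y =
      F y (w y) - F z (w y) + (F z x₀ - (F x₀ (w x₀) - F z (w x₀))) := by
    intro y hy hyz
    by_cases hyx : y = x₀
    · subst hyx
      abel
    · have h1 := hdiff y hy hyz x₀ hx₀ hx₀z hyx
      have h2 := hdiff x₀ hx₀ hx₀z y hy hyz (Ne.symm hyx)
      rw [hF, h1] at h2
      rw [← sub_eq_iff_eq_add] at h2
      rw [← h2]
      abel
  intro u hu v hv huv
  by_cases huz : u = z
  · subst huz
    simp only [if_true, Ne.symm huv, if_false, zero_add]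
    exact hzx v hv (Ne.symm huv)
  · by_cases hvz : v = z
    · subst hvz
      simp only [if_true, huv, if_false, add_zero]
      rw [hF]
      exact hzx u hu huv
    · simp only [huz, hvz, if_false]
      rw [hdiff u hu huz v hv hvz huv, hzx v hv hvz]
      abel

/-! ### The weighted Erdős–Ginzburg–Ziv theorem for prime moduli -/

/-- Weighted Erdős–Ginzburg–Ziv theorem: if the weights `d v` sum to zero in `ZMod p`, then among
at least `card V + p - 1` elements one can choose distinct ones, one for each weight, whose weighted
sum of values vanishes. If some value is taken at least as often as there are nonzero weights, this
value is used for all of them. Otherwise sort the elements by their values and distribute them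
cyclically among the nonzero weights; the values within each class are distinct, and the
Cauchy–Davenport theorem applies. -/
theorem exists_weighted_sum_eq_zero {V W : Type*} [Fintype V] [DecidableEq V] [DecidableEq W]
    {p : ℕ} (hp : p.Prime) {d : V → ZMod p} (hd : ∑ v, d v = 0) (h : W → ZMod p) {R : Finset W}
    (hR : Fintype.card V + p - 1 ≤ #R) :
    ∃ φ : V → W, Function.Injective φ ∧ (∀ v, φ v ∈ R) ∧ ∑ v, d v * h (φ v) = 0 := by
  have hFact := Fact.mk hp
  have hp2 := hp.two_le
  set D : Finset V := univ.filter fun v => d v ≠ 0 with hDdef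
  have hDV : #D ≤ Fintype.card V := Finset.card_le_univ D
  have hsumD : ∀ k : V → ZMod p, ∑ v, d v * k v = ∑ v ∈ D, d v * k v := by
    intro k
    symm
    refine Finset.sum_subset (subset_univ _) fun v _ hv => ?_
    have : d v = 0 := by simpa [hDdef] using hv
    rw [this, zero_mul]
  have hRpos : 0 < #R := by omega
  have hW : Nonempty W := let ⟨w, _⟩ := Finset.card_pos.1 hRpos; ⟨w⟩
  -- it suffices to treat the vertices of nonzero weight
  suffices hf : ∃ f : V → W, Set.InjOn f D ∧ (∀ v ∈ D, f v ∈ R) ∧ ∑ v ∈ D, d v * h (f v) = 0 by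
    obtain ⟨f, hf, hfR, hfsum⟩ := hf
    obtain ⟨φ, hφ, hφf, hφR⟩ := exists_injective_extension D R f hf hfR (by omega)
    refine ⟨φ, hφ, hφR, ?_⟩
    rw [hsumD fun v => h (φ v), ← hfsum]
    exact Finset.sum_congr rfl fun v hv => by rw [hφf v hv]
  by_cases hfib : ∃ t, #D ≤ #(R.filter fun w => h w = t)
  · obtain ⟨t, ht⟩ := hfib
    have ht' : Fintype.card ↥D ≤ Fintype.card ↥(R.filter fun w => h w = t) := by
      rwa [Fintype.card_coe, Fintype.card_coe]
    obtain ⟨e⟩ := Function.Embedding.nonempty_of_card_le ht'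
    let f : V → W := fun v => if hv : v ∈ D then e ⟨v, hv⟩ else hW.some
    have hf : ∀ v (hv : v ∈ D), f v = e ⟨v, hv⟩ := fun v hv => by simp [f, hv]
    refine ⟨f, ?_, ?_, ?_⟩
    · intro x hx y hy hxy
      rw [hf x hx, hf y hy] at hxy
      simpa using e.injective (Subtype.ext hxy)
    · intro v hv
      rw [hf v hv]
      exact (mem_filter.1 (e ⟨v, hv⟩).2).1
    · have h1 : ∀ v ∈ D, d v * h (f v) = d v * t := by
        intro v hv
        rw [hf v hv, (mem_filter.1 (e ⟨v, hv⟩).2).2]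
      rw [Finset.sum_congr rfl h1, ← hsumD fun _ => t, ← Finset.sum_mul, hd, zero_mul]
  · push Not at hfib
    have hm : 0 < #D := lt_of_le_of_lt (Nat.zero_le _) (hfib 0)
    let e := R.equivFin.symm
    let σ := Tuple.sort fun j : Fin #R => (h (e j)).val
    have hσ : Monotone ((fun j : Fin #R => (h (e j)).val) ∘ σ) := Tuple.monotone_sort _
    let x : Fin #R → W := fun j => e (σ j)
    have hx : Function.Injective x := fun i j hij =>
      σ.injective (e.injective (Subtype.ext hij))
    have hxR : ∀ j, x j ∈ R := fun j => (e (σ j)).2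
    have hmono : ∀ i j, i ≤ j → (h (x i)).val ≤ (h (x j)).val := fun i j hij => hσ hij
    let idx := D.equivFin
    let part : V → Finset (Fin #R) := fun v =>
      univ.filter fun j => ∃ hv : v ∈ D, (j : ℕ) % #D = idx ⟨v, hv⟩
    have hpart : ∀ v (hv : v ∈ D) j, j ∈ part v ↔ (j : ℕ) % #D = idx ⟨v, hv⟩ := by
      intro v hv j
      simp [part, hv]
    -- equal values occupy fewer than `#D` consecutive places
    have hclose : ∀ i j : Fin #R, i < j → h (x i) = h (x j) → (i : ℕ) % #D ≠ (j : ℕ) % #D := by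
      intro i j hij hh hmod
      have hge : (i : ℕ) + #D ≤ j := by
        have hlt : (i : ℕ) < j := hij
        have h1 := (Nat.modEq_iff_dvd' hlt.le).1 hmod
        have := Nat.le_of_dvd (by omega) h1
        omega
      have hsub : (Finset.Icc i j).image x ⊆ R.filter fun w => h w = h (x i) := by
        intro w hw
        obtain ⟨k, hk, rfl⟩ := mem_image.1 hw
        rw [Finset.mem_Icc] at hk
        refine mem_filter.2 ⟨hxR k, ?_⟩
        refine ZMod.val_injective p (le_antisymm ?_ (hmono i k hk.1))
        rw [hh]
        exact hmono k j hk.2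
      have h1 := Finset.card_le_card hsub
      rw [card_image_of_injective _ hx, Fin.card_Icc] at h1
      have h2 := hfib (h (x i))
      omega
    have hinj : ∀ v ∈ D, Set.InjOn (fun j => d v * h (x j)) (part v) := by
      intro v hv i hi j hj hij
      have hi' := (hpart v hv i).1 hi
      have hj' := (hpart v hv j).1 hj
      have hdv : d v ≠ 0 := by simpa [hDdef] using hv
      have hh : h (x i) = h (x j) := mul_left_cancel₀ hdv hij
      rcases lt_trichotomy i j with hlt | heq | hlt
      · exact absurd (hi'.trans hj'.symm) (hclose i j hlt hh)
      · exact heq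
      · exact absurd (hj'.trans hi'.symm) (hclose j i hlt hh.symm)
    have hne : ∀ v ∈ D, (part v).Nonempty := by
      intro v hv
      have hlt := (idx ⟨v, hv⟩).2
      refine ⟨⟨idx ⟨v, hv⟩, by omega⟩, (hpart v hv _).2 ?_⟩
      exact Nat.mod_eq_of_lt hlt
    have hsum : ∑ v ∈ D, #(part v) = #R := by
      rw [← Finset.card_biUnion]
      · have : D.biUnion part = univ := by
          ext j
          simp only [mem_biUnion, mem_univ, iff_true]
          have hlt := Nat.mod_lt (j : ℕ) hm
          refine ⟨idx.symm ⟨_, hlt⟩, (idx.symm ⟨_, hlt⟩).2, ?_⟩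
          rw [hpart _ (idx.symm ⟨_, hlt⟩).2]
          simp
        rw [this, card_univ, Fintype.card_fin]
      · intro u hu v hv huv
        rw [Function.onFun, Finset.disjoint_left]
        intro j hju hjv
        rw [hpart u hu] at hju
        rw [hpart v hv] at hjv
        have := idx.injective (Fin.ext (hju.symm.trans hjv))
        exact huv (by simpa using this)
    obtain ⟨g, hg, hgsum⟩ := exists_choice_sum_eq hp D
      (fun v => (part v).image fun j => d v * h (x j)) (fun v hv => (hne v hv).image _)
      (by
        have h1 : ∑ v ∈ D, (#((part v).image fun j => d v * h (x j)) - 1) + #D = #R := by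
          refine Eq.trans ?_ hsum
          rw [Finset.card_eq_sum_ones D, ← Finset.sum_add_distrib]
          refine Finset.sum_congr rfl fun v hv => ?_
          have := (hne v hv).card_pos
          rw [card_image_of_injOn (hinj v hv)]
          omega
        omega)
      0
    have hj : ∀ v ∈ D, ∃ j ∈ part v, d v * h (x j) = g v := fun v hv => mem_image.1 (hg v hv)
    have hFin : Nonempty (Fin #R) := ⟨⟨0, hRpos⟩⟩
    choose! j hjp hjg using hj
    refine ⟨fun v => x (j v), ?_, fun v _ => hxR _, ?_⟩
    · intro u hu v hv huv
      have h1 := (hpart u hu _).1 (hjp u hu)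
      have h2 := (hpart v hv _).1 (hjp v hv)
      rw [hx huv] at h1
      have := idx.injective (Fin.ext (h1.symm.trans h2))
      simpa using this
    · rw [← hgsum]
      exact Finset.sum_congr rfl fun v hv => hjg v hv

/-- Either there are disjoint sets of size `q` with property `B`, one for each element of `S`, or
there is a set that contains no such set and misses at most `q * (#S - 1)` elements. -/
lemma exists_disjoint_or_avoiding {V W : Type*} [DecidableEq V] [Fintype W] [DecidableEq W]
    (S : Finset V) (q : ℕ) (B : Finset W → Prop) :
    (∃ X : V → Finset W, (∀ v ∈ S, #(X v) = q ∧ B (X v)) ∧ (S : Set V).PairwiseDisjoint X) ∨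
    ∃ R : Finset W, Fintype.card W + q ≤ #R + q * #S ∧ ∀ X ⊆ R, #X = q → ¬ B X := by
  induction S using Finset.induction_on with
  | empty => exact Or.inl ⟨fun _ => ∅, by simp, by simp⟩
  | insert v S hv ih =>
    rw [card_insert_of_notMem hv]
    rcases ih with ⟨X, hX, hXd⟩ | ⟨R, hR, hRB⟩
    · by_cases hex : ∃ Y ⊆ (S.biUnion X)ᶜ, #Y = q ∧ B Y
      · obtain ⟨Y, hY, hYB⟩ := hex
        have hYX : ∀ u ∈ S, Disjoint Y (X u) := by
          intro u hu
          rw [Finset.disjoint_left]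
          intro w hw hwu
          exact (mem_compl.1 (hY hw)) (mem_biUnion.2 ⟨u, hu, hwu⟩)
        have hupd : ∀ u ∈ S, Function.update X v Y u = X u := fun u hu =>
          Function.update_of_ne (fun h : u = v => hv (h ▸ hu)) _ _
        refine Or.inl ⟨Function.update X v Y, ?_, ?_⟩
        · intro u hu
          rcases mem_insert.1 hu with rfl | hu
          · rwa [Function.update_self]
          · rw [hupd u hu]
            exact hX u hu
        · rw [coe_insert, Set.pairwiseDisjoint_insert_of_notMem (by simpa using hv)]
          refine ⟨fun u hu u' hu' huu => ?_, fun u hu => ?_⟩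
          · simp only [Function.onFun]
            rw [hupd u hu, hupd u' hu']
            exact hXd hu hu' huu
          · rw [Function.update_self, hupd u hu]
            exact hYX u hu
      · push Not at hex
        refine Or.inr ⟨(S.biUnion X)ᶜ, ?_, fun Y hY hq => hex Y hY hq⟩
        have h1 : #(S.biUnion X) = q * #S := by
          rw [Finset.card_biUnion hXd, Finset.sum_congr rfl fun u hu => (hX u hu).1, sum_const,
            smul_eq_mul, mul_comm]
        have h2 := Finset.card_le_univ (S.biUnion X)
        rw [Finset.card_compl, h1]
        rw [h1] at h2
        have : q * (#S + 1) = q * #S + q := by ring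
        omega
    · refine Or.inr ⟨R, ?_, hRB⟩
      have : q * (#S + 1) = q * #S + q := by ring
      omega

/-! ### Upper bounds -/

/-- Bookkeeping for the greedy extension of seeds of size `x` to sets of size `s`. -/
lemma sum_add_sum_sdiff_add_le {V : Type*} [DecidableEq V] {S : Finset V} {s x : V → ℕ}
    {A : Finset V} {v : V} {m ε : ℕ} (hv : v ∈ S) (hA : A ⊆ S) (hvA : v ∉ A)
    (hx : ∀ u ∈ S, x u ≤ s u) (hm : x v + m ≤ s v + ε) :
    ∑ u ∈ A, s u + ∑ u ∈ S \ A, x u + m ≤ ∑ u ∈ S, s u + ε := by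
  have hv' : v ∈ S \ A := mem_sdiff.2 ⟨hv, hvA⟩
  rw [← Finset.sum_sdiff hA, ← Finset.add_sum_erase _ _ hv', ← Finset.add_sum_erase _ s hv']
  have : ∑ u ∈ (S \ A).erase v, x u ≤ ∑ u ∈ (S \ A).erase v, s u :=
    Finset.sum_le_sum fun u hu => hx u (mem_sdiff.1 (mem_of_mem_erase hu)).1
  omega

lemma sum_eq_zero_of_mono {V W : Type*} [Fintype V] {G : SimpleGraph V} [DecidableRel G.Adj]
    {p : ℕ} (he : p ∣ #G.edgeFinset) {c : Sym2 W → ZMod p} {φ : V → W} {z : ZMod p}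
    (h : ∀ u v, G.Adj u v → c s(φ u, φ v) = z) : ∑ e ∈ G.edgeFinset, c (e.map φ) = 0 := by
  have h1 : ∀ e ∈ G.edgeFinset, c (e.map φ) = z := by
    intro e he
    induction e using Sym2.ind with
    | _ u v =>
      rw [SimpleGraph.mem_edgeFinset, SimpleGraph.mem_edgeSet] at he
      exact h u v he
  rw [Finset.sum_congr rfl h1, sum_const, nsmul_eq_mul, (ZMod.natCast_eq_zero_iff _ _).2 he,
    zero_mul]

/-- A packing of non-monochromatic triangles as a family of disjoint sets indexed by `S`. -/
lemma IsPacking.exists_family {V W Γ : Type*} [DecidableEq V] [DecidableEq W] [Nonempty W]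
    {S : Finset V} {F : W → W → Γ} (hF : ∀ u v, F u v = F v u) {l : List (W × W × W)}
    (hl : IsPacking F l) (hlen : l.length = #S) :
    ∃ a b w : V → W, (∀ v ∈ S, a v ≠ b v ∧ a v ≠ w v ∧ b v ≠ w v ∧
      F (a v) (w v) ≠ F (b v) (w v)) ∧
      (S : Set V).PairwiseDisjoint fun v => ({a v, b v, w v} : Finset W) := by
  have horient : ∀ T ∈ l, ∃ a b w : W, a ≠ b ∧ a ≠ w ∧ b ≠ w ∧ F a w ≠ F b w ∧
      ∀ v ∈ ({a, b, w} : Finset W), v ∈ verts [T] := by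
    rintro ⟨x, y, w⟩ hT
    have hnm := hl.1 _ hT
    have hnd := (hl.perm (List.perm_cons_erase hT)).2
    simp at hnd
    by_cases h : F x w = F y w
    · refine ⟨x, w, y, by grind, by grind, by grind, ?_, by simp⟩
      intro h'
      refine hnm ⟨?_, ?_⟩
      · exact h'.trans ((hF w y).trans h.symm)
      · exact h'.trans (hF w y)
    · exact ⟨x, y, w, by grind, by grind, by grind, h, by simp⟩
  choose! a b w hab haw hbw hne hmem using horient
  have hcard : #S = #l.toFinset := by rw [List.toFinset_card_of_nodup hl.nodup, hlen]
  let e := Finset.equivOfCardEq hcard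
  let τ : V → W × W × W := fun v => if h : v ∈ S then e ⟨v, h⟩ else Classical.arbitrary _
  have hτ : ∀ v (h : v ∈ S), τ v = e ⟨v, h⟩ := fun v h => by simp [τ, h]
  have hτl : ∀ v ∈ S, τ v ∈ l := by
    intro v hv
    rw [hτ v hv]
    exact List.mem_toFinset.1 (e ⟨v, hv⟩).2
  refine ⟨fun v => a (τ v), fun v => b (τ v), fun v => w (τ v), fun v hv => ?_, ?_⟩
  · exact ⟨hab _ (hτl v hv), haw _ (hτl v hv), hbw _ (hτl v hv), hne _ (hτl v hv)⟩
  · intro u hu v hv huv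
    rw [Function.onFun, Finset.disjoint_left]
    intro x hxu hxv
    have h1 := hl.eq_of_mem (hτl u hu) (hτl v hv) (hmem _ (hτl u hu) x hxu)
      (hmem _ (hτl v hv) x hxv)
    rw [hτ u hu, hτ v hv] at h1
    exact huv (by simpa using e.injective (Subtype.ext h1))

section Bounds

variable {V : Type*} [Fintype V] [DecidableEq V] {G : SimpleGraph V} [DecidableRel G.Adj]
  {S : Finset V}

lemma IsTwoPacking.pairwiseDisjoint (hS : IsTwoPacking G S) :
    (S : Set V).PairwiseDisjoint fun v => insert v (G.neighborFinset v) := by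
  intro u hu v hv huv
  rw [Function.onFun, Finset.disjoint_left]
  intro x hxu hxv
  simp only [mem_insert, SimpleGraph.mem_neighborFinset] at hxu hxv
  exact huv (hS.eq_of_common hu hv hxu hxv)

lemma IsTwoPacking.card_biUnion (hS : IsTwoPacking G S) :
    #(S.biUnion fun v => insert v (G.neighborFinset v)) = ∑ v ∈ S, (G.degree v + 1) := by
  rw [Finset.card_biUnion hS.pairwiseDisjoint]
  refine Finset.sum_congr rfl fun v _ => ?_
  rw [card_insert_of_notMem (by simp), SimpleGraph.card_neighborFinset_eq_degree]

lemma IsTwoPacking.sum_degree_le (hS : IsTwoPacking G S) :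
    ∑ v ∈ S, (G.degree v + 1) ≤ Fintype.card V := by
  rw [← hS.card_biUnion]
  exact Finset.card_le_univ _

/-- The constant `c` provides one spare vertex beyond the closed neighborhoods of `S`, except when
all degrees in `S` are one. -/
lemma IsTwoPacking.sum_degree_lt (hS : IsTwoPacking G S) (h1 : ¬ ∀ v ∈ S, G.degree v = 1) :
    ∑ v ∈ S, (G.degree v + 1) + 1 ≤ Fintype.card V + cConst G S := by
  have hle := hS.sum_degree_le
  unfold cConst
  split_ifs with hc
  · have hcov := hc.resolve_right h1
    have hne : S.biUnion (fun v => insert v (G.neighborFinset v)) ≠ univ := by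
      intro h
      apply hcov
      ext x
      have : x ∈ S.biUnion (fun v => insert v (G.neighborFinset v)) := h ▸ mem_univ x
      simp only [mem_biUnion, mem_insert, SimpleGraph.mem_neighborFinset] at this
      simp only [Set.mem_univ, Set.mem_iUnion, closedNeighborSet, Set.mem_union,
        SimpleGraph.mem_neighborSet, Set.mem_singleton_iff, true_iff]
      obtain ⟨v, hv, h⟩ := this
      exact ⟨v, hv, h.symm⟩
    have := Finset.card_lt_univ_of_notMem (Classical.not_forall.1
      (fun h => hne (Finset.eq_univ_iff_forall.2 h))).choose_spec
    rw [hS.card_biUnion] at this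
    omega
  · omega

variable {W : Type*} [Fintype W] [DecidableEq W] {p : ℕ}

/-- The upper bound in the case that no degree in the 2-packing `S` is divisible by `p`: either
there are `p - 1` disjoint non-monochromatic triangles, which extend to switches, or the coloring is
close enough to a monochromatic one to contain a monochromatic copy. -/
theorem exists_zero_sum_of_degree_ne_zero (hp : p.Prime) (he : p ∣ #G.edgeFinset)
    (hdeg : ∀ v ∈ S, 1 ≤ G.degree v) (hS : IsTwoPacking G S) (hcard : #S = p - 1)
    (hd : ∀ v ∈ S, (G.degree v : ZMod p) ≠ 0)
    (hN : Fintype.card V + p - 1 + cConst G S ≤ Fintype.card W) (c : Sym2 W → ZMod p) :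
    ∃ φ : V → W, Function.Injective φ ∧ ∑ e ∈ G.edgeFinset, c (e.map φ) = 0 := by
  have hFact := Fact.mk hp
  have hp2 := hp.two_le
  have hF : ∀ u v, c s(u, v) = c s(v, u) := fun u v => by rw [Sym2.eq_swap]
  have hn := hS.sum_degree_le
  have hn2 : 2 * #S ≤ ∑ v ∈ S, (G.degree v + 1) := by
    rw [mul_comm, ← smul_eq_mul]
    exact Finset.card_nsmul_le_sum _ _ _ fun v hv => by
      have := hdeg v hv
      omega
  have hW : Nonempty W := Fintype.card_pos_iff.1 (by omega)
  rcases exists_packing_or_clique (F := fun u v => c s(u, v)) hF (k := p - 1) (by omega)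
    (by omega) with ⟨l, hl, hlen⟩ | ⟨z, K, Y, a, hKY, hYk, hKYcard, hK, hY⟩
  · obtain ⟨a, b, w, habw, hdisj⟩ := hl.exists_family hF (hlen.trans hcard.symm)
    obtain ⟨U, hU, hUd⟩ := exists_disjoint_extension S (fun v => ({a v, b v, w v} : Finset W)) hdisj
      (fun v U => IsSwitch (fun x y => c s(x, y)) (G.degree v) U)
      (fun v => if G.degree v = 1 then 0 else G.degree v) (fun v => G.degree v + 2)
      (fun v U h => h.card)
      (by
        intro v hv P hP hm
        obtain ⟨h1, h2, h3, h4⟩ := habw v hv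
        refine exists_isSwitch_of_ne h1 h2 h3 h4 (hd v hv) hP ?_
        split_ifs at hm with h
        · exact Or.inr h
        · exact Or.inl hm)
      (by
        intro v hv A hA hvA
        have hsum : ∑ u ∈ S, (G.degree u + 2) = ∑ u ∈ S, (G.degree u + 1) + #S := by
          rw [Finset.card_eq_sum_ones, ← Finset.sum_add_distrib]
        have hx : ∀ u ∈ S, #({a u, b u, w u} : Finset W) ≤ G.degree u + 2 := by
          intro u hu
          have := hdeg u hu
          exact Finset.card_le_three.trans (by omega)
        have hx' : #({a v, b v, w v} : Finset W) ≤ 3 := Finset.card_le_three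
        have hdv := hdeg v hv
        by_cases h1 : ∀ u ∈ S, G.degree u = 1
        · have := sum_add_sum_sdiff_add_le (s := fun u => G.degree u + 2)
            (x := fun u => #({a u, b u, w u} : Finset W))
            (m := if G.degree v = 1 then 0 else G.degree v) (ε := 0) hv hA hvA hx
            (by rw [if_pos (h1 v hv)]; omega)
          refine this.trans ?_
          omega
        · have hlt := hS.sum_degree_lt h1
          have := sum_add_sum_sdiff_add_le (s := fun u => G.degree u + 2)
            (x := fun u => #({a u, b u, w u} : Finset W))
            (m := if G.degree v = 1 then 0 else G.degree v) (ε := 1) hv hA hvA hx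
            (by split_ifs <;> omega)
          refine this.trans ?_
          omega)
    exact exists_zero_sum_of_switches hp hS hcard.ge c hU hUd (by omega)
  · obtain ⟨φ, hφ, hφz⟩ := exists_mono_copy hS (F := fun u v => c s(u, v)) hF hKY (by omega)
      (by omega) hK hY
    exact ⟨φ, hφ, sum_eq_zero_of_mono he hφz⟩

/-- The upper bound without assumptions on the degrees: either there are `p - 1` disjoint
quadruples in which the difference of the colors of `aw` and `bw` depends on `w`, which extend to
switches, or the coloring is additive on a large set and the weighted Erdős–Ginzburg–Ziv theorem
applies, the degrees being the weights. -/
theorem exists_zero_sum_of_large (hp : p.Prime) (he : p ∣ #G.edgeFinset)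
    (hdeg : ∀ v ∈ S, 1 ≤ G.degree v) (hS : IsTwoPacking G S) (hcard : #S = p - 1)
    (hN : Fintype.card V + 5 * p - 8 ≤ Fintype.card W) (c : Sym2 W → ZMod p) :
    ∃ φ : V → W, Function.Injective φ ∧ ∑ e ∈ G.edgeFinset, c (e.map φ) = 0 := by
  have hp2 := hp.two_le
  have hF : ∀ u v, c s(u, v) = c s(v, u) := fun u v => by rw [Sym2.eq_swap]
  have hn := hS.sum_degree_le
  have hn2 : 2 * #S ≤ ∑ v ∈ S, (G.degree v + 1) := by
    rw [mul_comm, ← smul_eq_mul]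
    exact Finset.card_nsmul_le_sum _ _ _ fun v hv => by
      have := hdeg v hv
      omega
  have hW : Nonempty W := Fintype.card_pos_iff.1 (by omega)
  rcases exists_disjoint_or_avoiding (W := W) S 4 (fun X => ∃ a b w w' : W, X = {a, b, w, w'} ∧
    [a, b, w, w'].Nodup ∧ c s(a, w) - c s(b, w) ≠ c s(a, w') - c s(b, w')) with
    ⟨X, hX, hXd⟩ | ⟨R, hRcard, hR⟩
  · obtain ⟨U, hU, hUd⟩ := exists_disjoint_extension S X hXd
      (fun v U => IsSwitch (fun x y => c s(x, y)) (G.degree v) U)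
      (fun v => G.degree v - 1) (fun v => G.degree v + 2) (fun v U h => h.card)
      (by
        intro v hv P hP hm
        obtain ⟨-, a, b, w, w', hXeq, hnd, hne⟩ := hX v hv
        rw [hXeq] at hP ⊢
        exact exists_isSwitch_of_sub_ne (F := fun x y => c s(x, y)) hnd hne (hdeg v hv) hP hm)
      (by
        intro v hv A hA hvA
        have hsum : ∑ u ∈ S, (G.degree u + 3) = ∑ u ∈ S, (G.degree u + 1) + 2 * #S := by
          rw [Finset.card_eq_sum_ones, Finset.mul_sum, ← Finset.sum_add_distrib]
          exact Finset.sum_congr rfl fun u _ => by ring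
        have hle : ∑ u ∈ A, (G.degree u + 2) ≤ ∑ u ∈ A, (G.degree u + 3) :=
          Finset.sum_le_sum fun u _ => by omega
        have := sum_add_sum_sdiff_add_le (s := fun u => G.degree u + 3)
          (x := fun u => #(X u)) (m := G.degree v - 1) (ε := 0) hv hA hvA
          (fun u hu => by
            have := hdeg u hu
            rw [(hX u hu).1]
            omega)
          (by
            have := hdeg v hv
            rw [(hX v hv).1]
            omega)
        omega)
    exact exists_zero_sum_of_switches hp hS hcard.ge c hU hUd (by omega)
  · have hR4 : 4 ≤ #R := by omega
    obtain ⟨g, C, hg⟩ := exists_additive (F := fun x y => c s(x, y)) hF hR4 (by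
      intro x hx y hy w hw w' hw' hnd
      by_contra hne
      refine hR {x, y, w, w'} ?_ ?_ ⟨x, y, w, w', rfl, hnd, hne⟩
      · simp [Finset.insert_subset_iff, hx, hy, hw, hw']
      · have : ({x, y, w, w'} : Finset W) = [x, y, w, w'].toFinset := by simp
        rw [this, List.toFinset_card_of_nodup hnd]
        rfl)
    have hsum : ∑ v, (G.degree v : ZMod p) = 0 := by
      rw [← Nat.cast_sum, G.sum_degrees_eq_twice_card_edges, Nat.cast_mul,
        (ZMod.natCast_eq_zero_iff _ _).2 he, mul_zero]
    obtain ⟨φ, hφ, hφR, hφ0⟩ := exists_weighted_sum_eq_zero (W := W) hp hsum g (R := R) (by omega)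
    refine ⟨φ, hφ, ?_⟩
    rw [sum_edgeFinset_additive G (fun e => c (e.map φ)) (fun v => g (φ v)) C, hφ0,
      (ZMod.natCast_eq_zero_iff _ _).2 he, zero_mul, add_zero]
    intro u v huv
    exact hg _ (hφR u) _ (hφR v) (hφ.ne huv.ne)

end Bounds

/-! ### The zero-sum Ramsey number -/

section Ramsey

variable {V : Type*} {G : SimpleGraph V}

lemma forcesZeroSumCopy_of_forall [Fintype V] [DecidableEq V] [DecidableRel G.Adj] {Γ : Type*}
    [AddCommGroup Γ] {N : ℕ}
    (h : ∀ c : Sym2 (Fin N) → Γ, ∃ φ : V → Fin N, Function.Injective φ ∧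
      ∑ e ∈ G.edgeFinset, c (e.map φ) = 0) : ForcesZeroSumCopy G Γ N := by
  classical
  intro f
  obtain ⟨φ, hφ, hsum⟩ := h fun e =>
    if he : e ∈ (⊤ : SimpleGraph (Fin N)).edgeSet then f ⟨e, he⟩ else 0
  refine ⟨⟨⟨φ, fun {a b} hab => (SimpleGraph.top_adj _ _).2 (hφ.ne hab.ne)⟩, hφ⟩, ?_⟩
  rw [← hsum, copySum, Finset.sum_subtype G.edgeFinset (fun e => SimpleGraph.mem_edgeFinset)]
  refine Finset.sum_congr rfl fun e _ => ?_
  rw [dif_pos]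
  rfl

/-- If all degrees are congruent to the same `d ≢ 0` modulo `p`, then `K_N` with `N < n + p - 1` has
a coloring without zero-sum copies: color an edge by the number of its endpoints in a set of
`p - 1` vertices. Every copy uses between `1` and `p - 1` vertices of this set. -/
lemma not_forcesZeroSumCopy [Nonempty V] [Fintype V] [DecidableEq V] [DecidableRel G.Adj] {p : ℕ}
    (hp : p.Prime) {d : ℤ} (hd : ¬ d ≡ 0 [ZMOD (p : ℤ)])
    (hdeg : ∀ v : V, (G.degree v : ℤ) ≡ d [ZMOD (p : ℤ)]) {N : ℕ}
    (hN : N < Fintype.card V + p - 1) : ¬ ForcesZeroSumCopy G (ZMod p) N := by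
  have hFact := Fact.mk hp
  have hp2 := hp.two_le
  intro hf
  let h : Fin N → ZMod p := fun x => if (x : ℕ) < p - 1 then 1 else 0
  let c : Sym2 (Fin N) → ZMod p :=
    Sym2.lift ⟨fun x y => h x + h y, fun x y => add_comm _ _⟩
  obtain ⟨φ, hφ⟩ := hf fun e => c e
  have hinj : Function.Injective φ.toHom := φ.injective
  have hsum : ∑ e ∈ G.edgeFinset, c (e.map φ.toHom) = 0 := by
    rw [← hφ, copySum, Finset.sum_subtype G.edgeFinset (fun e => SimpleGraph.mem_edgeFinset)]
    rfl
  rw [sum_edgeFinset_additive G (fun e => c (e.map φ.toHom)) (fun v => h (φ.toHom v)) 0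
    (fun u v _ => by simp [c])] at hsum
  have hdeg' : ∀ v, (G.degree v : ZMod p) = (d : ZMod p) := by
    intro v
    have := (ZMod.intCast_eq_intCast_iff _ _ _).2 (hdeg v)
    simpa using this
  have hd' : (d : ZMod p) ≠ 0 := by
    intro h0
    apply hd
    rw [← ZMod.intCast_eq_intCast_iff]
    simpa using h0
  set B := univ.filter fun v => (φ.toHom v : ℕ) < p - 1 with hB
  have hcount : ∑ v, h (φ.toHom v) = (#B : ZMod p) := by
    simp only [h]
    rw [Finset.sum_boole]
  rw [mul_zero, add_zero, Finset.sum_congr rfl fun v _ => by rw [hdeg' v], ← Finset.mul_sum,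
    hcount] at hsum
  have hB0 := (mul_eq_zero.1 hsum).resolve_left hd'
  rw [ZMod.natCast_eq_zero_iff] at hB0
  have hBle : #B ≤ p - 1 := by
    have : #B ≤ #(Finset.range (p - 1)) := by
      refine Finset.card_le_card_of_injOn (fun v => (φ.toHom v : ℕ)) ?_ ?_
      · intro v hv
        have hv' := (mem_filter.1 hv).2
        simpa using hv'
      · intro u _ v _ huv
        exact hinj (Fin.ext huv)
    simpa using this
  have hBc : #Bᶜ ≤ N - (p - 1) := by
    have : #Bᶜ ≤ #(Finset.Ico (p - 1) N) := by
      refine Finset.card_le_card_of_injOn (fun v => (φ.toHom v : ℕ)) ?_ ?_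
      · intro v hv
        have hv' : v ∉ B := mem_compl.1 hv
        simp only [hB, mem_filter, mem_univ, true_and, not_lt] at hv'
        simp only [coe_Ico, Set.mem_Ico]
        exact ⟨hv', (φ.toHom v).2⟩
      · intro u _ v _ huv
        exact hinj (Fin.ext huv)
    simpa using this
  have hBsum := Finset.card_add_card_compl B
  have hB1 : #B = 0 := Nat.eq_zero_of_dvd_of_lt hB0 (by omega)
  have hV := Fintype.card_pos (α := V)
  omega

end Ramsey

end ZeroSumRamsey

/- All subtractions below are between natural numbers and never truncate, because `2 ≤ p`. -/
theorem theorem1 {V : Type*} [Fintype V] [DecidableEq V] (G : SimpleGraph V) [DecidableRel G.Adj]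
    (n p : ℕ) (hp : p.Prime) (hn : Fintype.card V = n)
    (he : p ∣ G.edgeFinset.card) (hmin : 1 ≤ G.minDegree)
    (S : Finset V) (hS : ZeroSumRamsey.IsTwoPacking G S) (hcard : S.card = p - 1) :
    ZeroSumRamsey.RamseyExists G (ZMod p) ∧
    (ZeroSumRamsey.sZero G p S = 0 →
      ZeroSumRamsey.ramseyNumber G (ZMod p) ≤ n + p - 1 + ZeroSumRamsey.cConst G S) ∧
    (ZeroSumRamsey.sZero G p S ≠ 0 →
      ZeroSumRamsey.ramseyNumber G (ZMod p) ≤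
        n + 5 * p - 9 + ZeroSumRamsey.sZero G p S + ZeroSumRamsey.cConst G S) ∧
    ZeroSumRamsey.ramseyNumber G (ZMod p) ≤ n + 6 * p - 9 ∧
    (ZeroSumRamsey.sZero G p S = 0 → ZeroSumRamsey.cConst G S = 0 →
      (∃ d : ℤ, ¬ d ≡ 0 [ZMOD (p : ℤ)] ∧ ∀ v : V, (G.degree v : ℤ) ≡ d [ZMOD (p : ℤ)]) →
      ZeroSumRamsey.ramseyNumber G (ZMod p) = n + p - 1) := by
  subst hn
  have hp2 := hp.two_le
  have hdeg : ∀ v ∈ S, 1 ≤ G.degree v := fun v _ => hmin.trans (G.minDegree_le_degree v)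
  have hlarge : ∀ N, Fintype.card V + 5 * p - 8 ≤ N →
      ZeroSumRamsey.ForcesZeroSumCopy G (ZMod p) N := fun N hN =>
    ZeroSumRamsey.forcesZeroSumCopy_of_forall
      (ZeroSumRamsey.exists_zero_sum_of_large hp he hdeg hS hcard (by simpa using hN))
  have hsmall : ZeroSumRamsey.sZero G p S = 0 → ZeroSumRamsey.ForcesZeroSumCopy G (ZMod p)
      (Fintype.card V + p - 1 + ZeroSumRamsey.cConst G S) := by
    intro hs
    refine ZeroSumRamsey.forcesZeroSumCopy_of_forall
      (ZeroSumRamsey.exists_zero_sum_of_degree_ne_zero hp he hdeg hS hcard ?_ (by simp))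
    intro v hv h0
    rw [ZeroSumRamsey.sZero, Finset.card_eq_zero, Finset.filter_eq_empty_iff] at hs
    exact hs hv (Nat.modEq_zero_iff_dvd.2 ((ZMod.natCast_eq_zero_iff _ _).1 h0))
  have hc : ZeroSumRamsey.cConst G S ≤ 1 := by
    unfold ZeroSumRamsey.cConst
    split_ifs <;> omega
  have hs : ZeroSumRamsey.sZero G p S ≤ p - 1 := hcard ▸ Finset.card_filter_le _ _
  have h1 : ZeroSumRamsey.sZero G p S = 0 → ZeroSumRamsey.ramseyNumber G (ZMod p) ≤
      Fintype.card V + p - 1 + ZeroSumRamsey.cConst G S := fun h => Nat.sInf_le (hsmall h)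
  have h2 : ZeroSumRamsey.sZero G p S ≠ 0 → ZeroSumRamsey.ramseyNumber G (ZMod p) ≤
      Fintype.card V + 5 * p - 9 + ZeroSumRamsey.sZero G p S + ZeroSumRamsey.cConst G S :=
    fun h => Nat.sInf_le (hlarge _ (by omega))
  refine ⟨⟨_, hlarge _ le_rfl⟩, h1, h2, ?_, ?_⟩
  · by_cases h : ZeroSumRamsey.sZero G p S = 0
    · have := h1 h
      omega
    · have := h2 h
      omega
  · rintro h0 hc0 ⟨d, hd, hdd⟩
    refine le_antisymm (by simpa [hc0] using h1 h0) ?_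
    by_contra! hlt
    obtain ⟨v, -⟩ := Finset.card_pos.1 (by omega : 0 < S.card)
    have : Nonempty V := ⟨v⟩
    have hmem : ZeroSumRamsey.ForcesZeroSumCopy G (ZMod p)
        (ZeroSumRamsey.ramseyNumber G (ZMod p)) :=
      Nat.sInf_mem (s := {N | ZeroSumRamsey.ForcesZeroSumCopy G (ZMod p) N})
        ⟨_, hlarge _ le_rfl⟩
    exact ZeroSumRamsey.not_forcesZeroSumCopy hp hd hdd hlt hmem
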